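/- Let $\mathbb F$ be a field, $P\subset\mathbf Z^2$ a finite interval (a nonempty, convex and connected subset of $\mathbf Z^2$ with the product order), $K$ a finite abstract simplicial complex, $\mathcal F$ an order-preserving map from $P$ to the poset of subcomplexes of $K$, and $M_{\mathcal F}:P\to\mathbf{vec}$ the persistence module obtained by applying simplicial homology $H_k(-;\mathbb F)$ in some degree $k\ge 0$. Write $\mathbf{Int}(P)$ for the set of intervals of $P$. For a $P$-module $M$ and $I\in\mathbf{Int}(P)$ let $\mathrm{rk}(M)(I)$ be the rank of the canonical map $\varprojlim M|_I\to\varinjlim M|_I$, and let $\mathrm{nbd}(I)$ be the set of $q\in P\setminus I$ such that $I\cup\{q\}$ is an interval. For $I\in\mathbf{Int}(P)$ let $\mathbb I_I$ be the interval module of $I$ ($\mathbb F$ on $I$ with identity maps inside $I$, and $0$ elsewhere). $M$ is interval decomposable if $M\cong\bigoplus_{j}\mathbb I_{I_j}$ for a family $(I_j)$ in $\mathbf{Int}(P)$; the multiset of the $I_j$ is the barcode $\mathrm{barc}(M)$. TrueInterval. Start with $M:=M_{\mathcal F}$. While $M\neq 0$: choose $p$ with $\dim M_p\neq 0$ and an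 interval $I\ni p$ of $P$ which is maximal among the intervals with $\mathrm{rk}(M)(I)>0$; choose a summand $N$ of $M$ with $N\cong\mathbb I_I^{\mu_I}$, where $\mu_I:=\mathrm{rk}(M)(I)$; output $(I,\mu_I)$ and replace $M$ by $M/N$. Interval. Put $d(p):=\dim (M_{\mathcal F})_p$ and $\mathrm{list}(p):=\emptyset$ for all $p\in P$. While some $p$ has $d(p)>0$, choose such a $p$ and put $I:=\{p\}$, $\mathrm{list}:=\mathrm{list}(p)$, with all points unmarked. While there is an unmarked $q\in\mathrm{nbd}(I)$, choose one and mark it; if $\mathrm{rk}(M_{\mathcal F})(I\cup\{q\})>\mathrm{Count}(\mathrm{list}\cap\mathrm{list}(q))$, replace $I$ by $I\cup\{q\}$ and $\mathrm{list}$ by $\mathrm{list}\cap\mathrm{list}(q)$. When no unmarked neighbor is left, output $(I,\mu_I)$ with $\mu_I:=\mathrm{rk}(M_{\mathcal F})(I)-\mathrm{Count}(\mathrm{list})$, give this output a new identifier, and for every $q\in I$ decrease $d(q)$ by $\mu_I$ and add the identifier to $\mathrm{list}(q)$. Here $\mathrm{Count}(L)$ is the sum of the multiplicities of the output intervals whose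 identifiers are in $L$. Proposition. Suppose that $M_{\mathcal F}$ is interval decomposable. Then, for all choices made on the way, both algorithms terminate (and no run gets stuck), and the output of any run of Interval coincides with the output of any run of TrueInterval: a pair $(I,\mu)$ is output by Interval if and only if it is output by TrueInterval, and this happens exactly if $I$ belongs to $\mathrm{barc}(M_{\mathcal F})$ with multiplicity $\mu$. In each of the two outputs every interval is listed only once. -/

import Mathlib

universe u v w x

namespace GenPers

/-! ## Persistence modules over a poset -/

/-- A persistence module over the poset `Q`: a functor from `Q` to vector spaces over `F`. -/
structure PModule (F : Type u) [Field F] (Q : Type v) [PartialOrder Q] where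
  obj : Q → Type w
  [acg : ∀ p, AddCommGroup (obj p)]
  [mod : ∀ p, Module F (obj p)]
  map : ∀ {p q : Q}, p ≤ q → obj p →ₗ[F] obj q
  map_id : ∀ p, map (le_refl p) = LinearMap.id
  map_comp : ∀ {p q r : Q} (h₁ : p ≤ q) (h₂ : q ≤ r), map (h₁.trans h₂) = map h₂ ∘ₗ map h₁

attribute [instance] PModule.acg PModule.mod

variable {F : Type u} [Field F] {Q : Type v} [PartialOrder Q]

/-- Isomorphisms of persistence modules. -/
structure PModule.Iso (M : PModule.{u, v, w} F Q) (N : PModule.{u, v, x} F Q) where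
  equiv : ∀ p, M.obj p ≃ₗ[F] N.obj p
  natural : ∀ {p q : Q} (h : p ≤ q) (a : M.obj p), equiv q (M.map h a) = N.map h (equiv p a)

/-- The (external) direct sum of a family of persistence modules, formed pointwise. -/
def PModule.directSum {ι : Type x} (N : ι → PModule.{u, v, w} F Q) : PModule F Q where
  obj p := DirectSum ι fun j => (N j).obj p
  map h := DirectSum.lmap fun j => (N j).map h
  map_id p := by
    ext a j
    simp [(N _).map_id]
  map_comp h₁ h₂ := by
    ext a j
    simp [(N _).map_comp h₁ h₂]

/-- The restriction of a persistence module to a subset. -/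
def PModule.restrict (M : PModule.{u, v, w} F Q) (S : Finset Q) : PModule.{u, v, w} F S where
  obj p := M.obj p
  map {p q} h := M.map (p := (p : Q)) (q := (q : Q)) h
  map_id p := M.map_id p
  map_comp {p q r} h₁ h₂ := M.map_comp (p := (p : Q)) (q := (q : Q)) (r := (r : Q)) h₁ h₂

/-- Submodules of a persistence module. -/
structure PModule.Sub (M : PModule.{u, v, w} F Q) where
  carrier : ∀ p, Submodule F (M.obj p)
  map_mem : ∀ {p q : Q} (h : p ≤ q) (a : M.obj p), a ∈ carrier p → M.map h a ∈ carrier q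

/-- A submodule, seen as a persistence module. -/
def PModule.Sub.toPModule {M : PModule.{u, v, w} F Q} (N : M.Sub) : PModule.{u, v, w} F Q where
  obj p := N.carrier p
  map h := (M.map h).restrict fun a ha => N.map_mem h a ha
  map_id p := by
    ext a
    simp [LinearMap.restrict_apply, M.map_id]
  map_comp h₁ h₂ := by
    ext a
    simp [LinearMap.restrict_apply, M.map_comp h₁ h₂]

/-- The pointwise quotient `M / N`. -/
def PModule.Sub.quotient {M : PModule.{u, v, w} F Q} (N : M.Sub) : PModule.{u, v, w} F Q where
  obj p := M.obj p ⧸ N.carrier p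
  map {p q} h := (N.carrier p).mapQ (N.carrier q) (M.map h) fun a ha => N.map_mem h a ha
  map_id p := by
    ext a
    simp [M.map_id]
  map_comp h₁ h₂ := by
    ext a
    simp [M.map_comp h₁ h₂]

/-- A submodule is a summand if it has a complementary submodule. -/
def PModule.Sub.IsSummand {M : PModule.{u, v, w} F Q} (N : M.Sub) : Prop :=
  ∃ N' : M.Sub, ∀ p, IsCompl (N.carrier p) (N'.carrier p)

/-! ## Intervals, interval modules, barcodes -/

/-- Intervals of a poset: nonempty, convex and connected subsets. -/
def IsInterval (I : Set Q) : Prop :=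
  I.Nonempty ∧
  (∀ p ∈ I, ∀ q ∈ I, ∀ r, p ≤ r → r ≤ q → r ∈ I) ∧
  (∀ p ∈ I, ∀ q ∈ I,
    Relation.ReflTransGen (fun a b => a ∈ I ∧ b ∈ I ∧ (a ≤ b ∨ b ≤ a)) p q)

variable (Q) in
/-- `FinInterval Q` is the set `Int(Q)` of finite intervals of `Q`. -/
@[ext]
structure FinInterval where
  carrier : Finset Q
  isInterval : IsInterval (carrier : Set Q)

instance : Membership Q (FinInterval Q) := ⟨fun I p => p ∈ I.carrier⟩

instance [DecidableEq Q] (p : Q) (I : FinInterval Q) : Decidable (p ∈ I) :=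
  inferInstanceAs (Decidable (p ∈ I.carrier))

instance (I : FinInterval Q) : Nonempty I.carrier :=
  I.isInterval.1.to_subtype

/-- The one-point interval. -/
def FinInterval.single (p : Q) : FinInterval Q where
  carrier := {p}
  isInterval := by
    refine ⟨⟨p, by simp⟩, ?_, ?_⟩
    · intro a ha b hb r har hrb
      simp only [Finset.coe_singleton, Set.mem_singleton_iff] at *
      subst ha hb
      exact le_antisymm hrb har
    · intro a ha b hb
      simp only [Finset.coe_singleton, Set.mem_singleton_iff] at *
      subst ha hb
      exact Relation.ReflTransGen.refl

/-- The neighborhood `nbd(I)` of an interval `I` in the poset `Q`. -/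
def FinInterval.nbd (I : FinInterval Q) : Set Q :=
  {q | q ∉ I ∧ IsInterval (insert q (I.carrier : Set Q))}

/-- The interval `I ∪ {q}`, for `q` in the neighborhood of `I`. -/
def FinInterval.add [DecidableEq Q] (I : FinInterval Q) (q : Q) (hq : q ∈ I.nbd) :
    FinInterval Q where
  carrier := insert q I.carrier
  isInterval := by
    rw [Finset.coe_insert]
    exact hq.2

/-- For an interval `P` of a poset, the neighborhood of `I` in `P` consists of the points of `P`
which lie in the neighborhood of `I` in the big poset. -/
theorem mem_nbd_iff_of_isInterval {P : Finset Q} (hP : IsInterval (P : Set Q))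
    (I : FinInterval P) (q : P) :
    q ∈ I.nbd ↔ (q : Q) ∉ ((↑) : P → Q) '' (I.carrier : Set P) ∧
      IsInterval (insert (q : Q) (((↑) : P → Q) '' (I.carrier : Set P))) := by
  rw [← Set.image_insert_eq]
  have key : ∀ S : Set P, IsInterval S ↔ IsInterval (((↑) : P → Q) '' S) := by
    intro S
    constructor
    · rintro ⟨h1, h2, h3⟩
      refine ⟨h1.image _, ?_, ?_⟩
      · rintro _ ⟨a, ha, rfl⟩ _ ⟨b, hb, rfl⟩ r har hrb
        have hr : r ∈ P := hP.2.1 _ a.2 _ b.2 r har hrb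
        exact ⟨⟨r, hr⟩, h2 a ha b hb ⟨r, hr⟩ har hrb, rfl⟩
      · rintro _ ⟨a, ha, rfl⟩ _ ⟨b, hb, rfl⟩
        exact (h3 a ha b hb).lift _ fun c d ⟨hc, hd, hcd⟩ =>
          ⟨⟨c, hc, rfl⟩, ⟨d, hd, rfl⟩, hcd⟩
    · rintro ⟨h1, h2, h3⟩
      refine ⟨Set.image_nonempty.1 h1, ?_, ?_⟩
      · intro a ha b hb r har hrb
        obtain ⟨r', hr', h⟩ := h2 a ⟨a, ha, rfl⟩ b ⟨b, hb, rfl⟩ r har hrb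
        rwa [← Subtype.ext h]
      · intro a ha b hb
        have h := h3 a ⟨a, ha, rfl⟩ b ⟨b, hb, rfl⟩
        have aux : ∀ c : Q, Relation.ReflTransGen (fun a b => a ∈ ((↑) : P → Q) '' S ∧
            b ∈ ((↑) : P → Q) '' S ∧ (a ≤ b ∨ b ≤ a)) a c → ∀ c' : P, (c' : Q) = c →
            Relation.ReflTransGen (fun a b => a ∈ S ∧ b ∈ S ∧ (a ≤ b ∨ b ≤ a)) a c' := by
          intro c hc
          induction hc with
          | refl =>
            intro c' hc'
            rw [Subtype.ext hc']
          | tail _ hbc ih =>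
            intro c' hc'
            obtain ⟨⟨d, hd, rfl⟩, ⟨e, he, rfl⟩, hde⟩ := hbc
            obtain rfl := Subtype.ext hc'
            exact (ih d rfl).tail ⟨hd, he, hde⟩
        exact aux _ h b rfl
  rw [← key]
  change (_ ∧ _) ↔ _
  refine and_congr_left fun _ => not_congr ?_
  constructor
  · exact fun h => ⟨q, h, rfl⟩
  · rintro ⟨r, hr, h⟩
    rw [← Subtype.ext h]
    exact hr

/-- The interval module of `I`: at `p` it is `F` (as the top subspace of `F`) if `p ∈ I` and `0`
otherwise, with identity maps inside `I` and zero maps elsewhere. -/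
def intervalModule (F : Type u) [Field F] [DecidableEq Q] (I : FinInterval Q) :
    PModule.{u, v, u} F Q where
  obj p := (if p ∈ I then ⊤ else ⊥ : Submodule F F)
  map {p q} h := LinearMap.restrict (if p ∈ I ∧ q ∈ I then LinearMap.id else 0) (by
    intro a ha
    by_cases hq : q ∈ I
    · simp [hq]
    · simp [hq])
  map_id p := by
    ext ⟨a, ha⟩
    by_cases hp : p ∈ I
    · simp [LinearMap.restrict_apply, hp]
    · simp only [hp, if_false, Submodule.mem_bot] at ha
      simp [LinearMap.restrict_apply, hp, ha]
  map_comp {p q r} h₁ h₂ := by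
    ext ⟨a, ha⟩
    by_cases hp : p ∈ I
    · by_cases hr : r ∈ I
      · have hq : q ∈ I := I.isInterval.2.1 p hp r hr q h₁ h₂
        simp [LinearMap.restrict_apply, hp, hq, hr]
      · simp [LinearMap.restrict_apply, hr]
    · simp [LinearMap.restrict_apply, hp]

/-- The family `B` of intervals is the barcode of `M`: `M` is isomorphic to the direct sum of the
interval modules of the `B j`. The multiset of the `B j` is then the barcode. -/
def PModule.IsBarcode [DecidableEq Q] {ι : Type x} (M : PModule.{u, v, w} F Q)
    (B : ι → FinInterval Q) : Prop :=
  Nonempty (M.Iso (PModule.directSum fun j => intervalModule F (B j)))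

/-- The multiplicity of `I` in the multiset of the `B j`. -/
noncomputable def barMult {ι : Type x} (B : ι → FinInterval Q) (I : FinInterval Q) : ℕ :=
  Nat.card {j // B j = I}

/-! ## The generalized rank invariant -/

/-- The limit of `M`: the space of sections. -/
def PModule.limit (M : PModule.{u, v, w} F Q) : Submodule F (∀ p, M.obj p) where
  carrier := {s | ∀ {p q : Q} (h : p ≤ q), M.map h (s p) = s q}
  add_mem' := by
    intro a b ha hb p q h
    simp [ha h, hb h]
  zero_mem' := by
    intro p q h
    simp
  smul_mem' := by
    intro c a ha p q h
    simp [ha h]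

/-- The subspace of the direct sum of the `M.obj p` spanned by the relations that identify a vector
with its images under the structure maps. -/
def PModule.colimitRel [DecidableEq Q] (M : PModule.{u, v, w} F Q) :
    Submodule F (DirectSum Q M.obj) :=
  Submodule.span F {y | ∃ (p q : Q) (h : p ≤ q) (a : M.obj p),
    y = DirectSum.lof F Q M.obj p a - DirectSum.lof F Q M.obj q (M.map h a)}

/-- The colimit of `M`. -/
abbrev PModule.colimit [DecidableEq Q] (M : PModule.{u, v, w} F Q) :=
  DirectSum Q M.obj ⧸ M.colimitRel

/-- The canonical map from the limit to the colimit, through the point `p`. -/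
def PModule.limToColim [DecidableEq Q] (M : PModule.{u, v, w} F Q) (p : Q) :
    M.limit →ₗ[F] M.colimit :=
  M.colimitRel.mkQ ∘ₗ DirectSum.lof F Q M.obj p ∘ₗ LinearMap.proj p ∘ₗ M.limit.subtype

/-- The canonical map does not change along comparable points, so over a connected poset it does
not depend on the point. -/
theorem PModule.limToColim_eq_of_le [DecidableEq Q] (M : PModule.{u, v, w} F Q) {p q : Q}
    (h : p ≤ q) : M.limToColim p = M.limToColim q := by
  ext s
  simp only [limToColim, LinearMap.comp_apply, Submodule.mkQ_apply, LinearMap.proj_apply,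
    Submodule.subtype_apply]
  rw [Submodule.Quotient.eq, ← s.2 h]
  exact Submodule.subset_span ⟨p, q, h, _, rfl⟩

/-- The generalized rank of a persistence module over a nonempty (connected) poset: the rank of the
canonical map from the limit to the colimit, taken through any point. -/
noncomputable def PModule.rank [DecidableEq Q] [Nonempty Q] (M : PModule.{u, v, w} F Q) : ℕ :=
  Module.finrank F (LinearMap.range (M.limToColim (Classical.arbitrary Q)))

/-- The generalized rank invariant `rk(M)(I) = rank(M|_I)`. -/
noncomputable def PModule.rk [DecidableEq Q] (M : PModule.{u, v, w} F Q) (I : FinInterval Q) : ℕ :=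
  (M.restrict I.carrier).rank

/-- `I` is a maximal interval with positive generalized rank. -/
def PModule.IsMaximalInterval [DecidableEq Q] (M : PModule.{u, v, w} F Q) (I : FinInterval Q) :
    Prop :=
  0 < M.rk I ∧ ∀ J : FinInterval Q, I.carrier ⊂ J.carrier → M.rk J = 0

/-! ## The algorithm TrueInterval -/

/-- The output of either algorithm: the list of the pairs (interval, multiplicity), in the order in
which they are found. -/
abbrev Output (Q : Type v) [PartialOrder Q] := List (FinInterval Q × ℤ)

/-- A state of TrueInterval: the current module and the pairs output so far. -/
structure TrueState (F : Type u) [Field F] (Q : Type v) [PartialOrder Q] where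
  module : PModule.{u, v, w} F Q
  out : Output Q

/-- One round of TrueInterval: choose a point `p` where the current module `M` does not vanish and a
maximal interval `I` of `M` that contains `p`, output `I` with multiplicity `μ = rk(M)(I)`, and
replace `M` by its quotient by a summand isomorphic to the direct sum of `μ` copies of the interval
module of `I`. All choices are left open. -/
inductive TrueStep [DecidableEq Q] : TrueState.{u, v, w} F Q → TrueState.{u, v, w} F Q → Prop
  | peel (M : PModule.{u, v, w} F Q) (out : Output Q) (p : Q) (I : FinInterval Q) (N : M.Sub)
      (hp : Module.finrank F (M.obj p) ≠ 0) (hpI : p ∈ I) (hI : M.IsMaximalInterval I)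
      (hN : N.IsSummand)
      (hNI : Nonempty
        (N.toPModule.Iso (PModule.directSum fun _ : Fin (M.rk I) => intervalModule F I))) :
      TrueStep ⟨M, out⟩ ⟨N.quotient, out ++ [(I, (M.rk I : ℤ))]⟩

/-- TrueInterval stops when the current module vanishes everywhere. -/
def TrueState.IsFinal (s : TrueState.{u, v, w} F Q) : Prop :=
  ∀ p, Module.finrank F (s.module.obj p) = 0

/-- `out` is the output of some complete run of TrueInterval on `M`. -/
def TrueIntervalOutputs [DecidableEq Q] (M : PModule.{u, v, w} F Q) (out : Output Q) : Prop :=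
  ∃ s : TrueState.{u, v, w} F Q,
    Relation.ReflTransGen TrueStep ⟨M, []⟩ s ∧ s.IsFinal ∧ s.out = out

/-! ## The algorithm Interval -/

/-- The global variables of Interval: the counters `d(p)`, the identifier lists `list(p)`, and the
pairs output so far. The identifier of an interval that has been output is its position in `out`. -/
structure Store (Q : Type v) [PartialOrder Q] where
  d : Q → ℤ
  list : Q → Finset ℕ
  out : Output Q

/-- The routine Count: the sum of the multiplicities of the output intervals whose identifiers
belong to `l`. -/
def Store.count (s : Store Q) (l : Finset ℕ) : ℤ :=
  ∑ i ∈ l, (s.out[i]?.map Prod.snd).getD 0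

/-- Output `I` with multiplicity `μ`, and update the counters and lists of the points of `I`. -/
def Store.record [DecidableEq Q] (s : Store Q) (I : FinInterval Q) (μ : ℤ) : Store Q where
  d q := if q ∈ I then s.d q - μ else s.d q
  list q := if q ∈ I then insert s.out.length (s.list q) else s.list q
  out := s.out ++ [(I, μ)]

/-- A state of Interval: either at the head of the main loop, or during the search for a maximal
interval, with the current interval `I`, its identifier list and the set of marked points. -/
inductive IntervalState (Q : Type v) [PartialOrder Q]
  | head (s : Store Q)
  | search (s : Store Q) (I : FinInterval Q) (list : Finset ℕ) (marked : Finset Q)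

/-- The steps of Interval on the module `M`. All choices are left open. -/
inductive IntervalStep [DecidableEq Q] (M : PModule.{u, v, w} F Q) :
    IntervalState Q → IntervalState Q → Prop
  /-- Start a search from a point whose counter is positive. -/
  | start (s : Store Q) (p : Q) (hp : 0 < s.d p) :
      IntervalStep M (.head s) (.search s (.single p) (s.list p) ∅)
  /-- An unmarked neighbor is examined, marked, and added to the interval. -/
  | accept (s : Store Q) (I : FinInterval Q) (list : Finset ℕ) (marked : Finset Q) (q : Q)
      (hq : q ∈ I.nbd) (hm : q ∉ marked)
      (h : s.count (list ∩ s.list q) < M.rk (I.add q hq)) :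
      IntervalStep M (.search s I list marked)
        (.search s (I.add q hq) (list ∩ s.list q) (insert q marked))
  /-- An unmarked neighbor is examined, marked, and not added to the interval. -/
  | reject (s : Store Q) (I : FinInterval Q) (list : Finset ℕ) (marked : Finset Q) (q : Q)
      (hq : q ∈ I.nbd) (hm : q ∉ marked)
      (h : (M.rk (I.add q hq) : ℤ) ≤ s.count (list ∩ s.list q)) :
      IntervalStep M (.search s I list marked) (.search s I list (insert q marked))
  /-- No unmarked neighbor is left: output the interval and return to the main loop. -/
  | finish (s : Store Q) (I : FinInterval Q) (list : Finset ℕ) (marked : Finset Q)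
      (h : ∀ q ∈ I.nbd, q ∈ marked) :
      IntervalStep M (.search s I list marked) (.head (s.record I (M.rk I - s.count list)))

/-- The initial state of Interval. -/
noncomputable def intervalStart (M : PModule.{u, v, w} F Q) : IntervalState Q :=
  .head ⟨fun p => (Module.finrank F (M.obj p) : ℤ), fun _ => ∅, []⟩

/-- Interval stops at the head of the main loop when no counter is positive. -/
def IntervalState.IsFinal : IntervalState Q → Prop
  | .head s => ∀ p, s.d p ≤ 0
  | .search _ _ _ _ => False

/-- `out` is the output of some complete run of Interval on `M`. -/
def IntervalOutputs [DecidableEq Q] (M : PModule.{u, v, w} F Q) (out : Output Q) : Prop :=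
  ∃ s : Store Q, Relation.ReflTransGen (IntervalStep M) (intervalStart M) (.head s) ∧
    (IntervalState.head s).IsFinal ∧ s.out = out

/-- Every run from `s` is finite, and it can only end in a final state. -/
def AlwaysHalts {σ : Type w} (step : σ → σ → Prop) (final : σ → Prop) (s : σ) : Prop :=
  Acc (fun b a => step a b) s ∧
    ∀ t, Relation.ReflTransGen step s t → final t ∨ ∃ t', step t t'

/-! ## The homology module of a simplicial filtration -/

section Homology

/-- The quotient `Z / (Z ∩ B)` of subspaces of a vector space, `Z / B` when `B ≤ Z`. -/
def SubQuot {E : Type v} [AddCommGroup E] [Module F E] (Z B : Submodule F E) :=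
  Z ⧸ B.submoduleOf Z

instance {E : Type v} [AddCommGroup E] [Module F E] (Z B : Submodule F E) :
    AddCommGroup (SubQuot Z B) :=
  inferInstanceAs (AddCommGroup (Z ⧸ B.submoduleOf Z))

instance {E : Type v} [AddCommGroup E] [Module F E] (Z B : Submodule F E) :
    Module F (SubQuot Z B) :=
  inferInstanceAs (Module F (Z ⧸ B.submoduleOf Z))

/-- The map `Z / B → Z' / B'` induced by inclusions. -/
def SubQuot.map {E : Type v} [AddCommGroup E] [Module F E] {Z B Z' B' : Submodule F E}
    (hZ : Z ≤ Z') (hB : B ≤ B') : SubQuot Z B →ₗ[F] SubQuot Z' B' :=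
  Submodule.mapQ (B.submoduleOf Z) (B'.submoduleOf Z') (Submodule.inclusion hZ)
    fun _ ha => hB ha

variable {V : Type v} [LinearOrder V]

/-- The simplicial boundary map on formal combinations of finite vertex sets, with the orientation
given by the order of the vertices; the boundary of a vertex is zero. -/
noncomputable def boundary (F : Type u) [Field F] (V : Type v) [LinearOrder V] :
    (Finset V →₀ F) →ₗ[F] (Finset V →₀ F) :=
  Finsupp.linearCombination F fun σ =>
    if σ.card ≤ 1 then 0
    else ∑ a ∈ σ, Finsupp.single (σ.erase a) ((-1 : F) ^ (σ.filter (· < a)).card)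

/-- The simplicial `k`-chains of a simplicial complex. -/
def chains {V : Type v} (F : Type u) [Field F] (A : PreAbstractSimplicialComplex V) (k : ℕ) :
    Submodule F (Finset V →₀ F) :=
  Finsupp.supported F F {σ | σ ∈ A ∧ σ.card = k + 1}

/-- The simplicial `k`-cycles. -/
noncomputable def cycles (F : Type u) [Field F] (A : PreAbstractSimplicialComplex V) (k : ℕ) :
    Submodule F (Finset V →₀ F) :=
  chains F A k ⊓ LinearMap.ker (boundary F V)

/-- The simplicial `k`-boundaries. -/
noncomputable def boundaries (F : Type u) [Field F] (A : PreAbstractSimplicialComplex V) (k : ℕ) :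
    Submodule F (Finset V →₀ F) :=
  (chains F A (k + 1)).map (boundary F V)

theorem chains_mono {V : Type v} {A A' : PreAbstractSimplicialComplex V} (h : A ≤ A') (k : ℕ) :
    chains F A k ≤ chains F A' k :=
  Finsupp.supported_mono fun _ hσ => ⟨h hσ.1, hσ.2⟩

theorem cycles_mono {A A' : PreAbstractSimplicialComplex V} (h : A ≤ A') (k : ℕ) :
    cycles F A k ≤ cycles F A' k :=
  inf_le_inf_right _ (chains_mono h k)

theorem boundaries_mono {A A' : PreAbstractSimplicialComplex V} (h : A ≤ A') (k : ℕ) :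
    boundaries F A k ≤ boundaries F A' k :=
  Submodule.map_mono (chains_mono h (k + 1))

/-- The `k`-th simplicial homology: cycles modulo boundaries. -/
abbrev Homology (F : Type u) [Field F] (A : PreAbstractSimplicialComplex V) (k : ℕ) :=
  SubQuot (cycles F A k) (boundaries F A k)

/-- The map on homology induced by an inclusion. -/
noncomputable def homologyMap (F : Type u) [Field F] {A A' : PreAbstractSimplicialComplex V}
    (h : A ≤ A') (k : ℕ) : Homology F A k →ₗ[F] Homology F A' k :=
  SubQuot.map (cycles_mono h k) (boundaries_mono h k)

/-- The module induced by a filtration `𝓕` of `K` through the `k`-th simplicial homology. -/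
noncomputable def homologyModule (F : Type u) [Field F] {Q : Type w} [PartialOrder Q]
    {K : PreAbstractSimplicialComplex V} (𝓕 : Q →o Set.Iic K) (k : ℕ) : PModule F Q where
  obj p := Homology F (𝓕 p).1 k
  map h := homologyMap F (𝓕.monotone h) k
  map_id p := by
    refine LinearMap.ext fun a => ?_
    obtain ⟨a, rfl⟩ := Submodule.Quotient.mk_surjective _ a
    rfl
  map_comp h₁ h₂ := by
    refine LinearMap.ext fun a => ?_
    obtain ⟨a, rfl⟩ := Submodule.Quotient.mk_surjective _ a
    rfl

end Homology

end GenPers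

/-! In coordinates adapted to the barcode, every quantity in the two algorithms becomes a count of
bars. By `BarCoords.rk_eq` the rank at `I` is the number of bars containing `I`: a bar that misses a
point of `I` contributes nothing to the map from the limit to the colimit, while a bar containing
`I` contributes a constant section that survives.

For TrueInterval, maximality of `I` forces every bar containing `I` to equal `I`, so the rank is its
multiplicity. The summand `N` is arbitrary, but the submodule `R` spanned by the bars other than `I`
is always a complement of it (`BarCoords.isCompl_of_isSummand`). Indeed, a vector of `N ∩ R` at a
point of `I` extends to a section of `N` over `I`. This section dies in the colimit of `M` because
it lies in `R` at that point, yet the projection onto `N` recovers it from the colimit, so it is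
zero. A dimension count then gives the complement. Hence `M / N ≅ R`, which has the old barcode
without the copies of `I`, and no uniqueness theorem for decompositions is needed.

For Interval the module stays fixed, and rank minus Count is the number of bars containing `I` that
are not yet output (`BarCoords.rk_eq_count_add`). So a neighbor is accepted exactly if some
remaining bar contains the enlarged interval, and a rejected point stays useless as `I` grows. A
remaining bar strictly larger than `I` would contain a point of `nbd(I)`
(`FinInterval.exists_mem_nbd`), so when all neighbors are marked, `I` is itself a bar. -/

namespace GenPers

/-! ## Coordinates adapted to a barcode -/

section Coordinates

variable {F : Type*} [Field F] {Q : Type*} [PartialOrder Q] {ι : Type*}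

/-- Coordinates on a persistence module that exhibit it as the sum of the interval modules of a
family `B` of intervals. -/
structure BarCoords (M : PModule F Q) (B : ι → FinInterval Q) where
  coord : ∀ p, M.obj p →ₗ[F] (ι → F)
  inj : ∀ p, Function.Injective (coord p)
  zero : ∀ p a j, p ∉ B j → coord p a j = 0
  surj : ∀ p (f : ι → F), (∀ j, p ∉ B j → f j = 0) → ∃ a, coord p a = f
  -- At the bars that miss `q`, `zero` already forces the coordinate of the image to vanish.
  map : ∀ {p q : Q} (h : p ≤ q) a j, q ∈ B j → coord q (M.map h a) j = coord p a j

/-- Transport of coordinates along an isomorphism. -/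
def BarCoords.ofIso {M : PModule F Q} {N : PModule F Q} {B : ι → FinInterval Q}
    (c : BarCoords N B) (e : M.Iso N) : BarCoords M B where
  coord p := c.coord p ∘ₗ (e.equiv p).toLinearMap
  inj p := (c.inj p).comp (e.equiv p).injective
  zero p a j h := c.zero p _ j h
  surj p f hf := by
    obtain ⟨a, rfl⟩ := c.surj p f hf
    exact ⟨(e.equiv p).symm a, by simp⟩
  map h a j hj := by
    simpa [e.natural h a] using c.map h (e.equiv _ a) j hj

/-- Modules with the same coordinates are isomorphic. -/
theorem BarCoords.nonempty_iso {M : PModule F Q} {N : PModule F Q} {B : ι → FinInterval Q}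
    (c : BarCoords M B) (c' : BarCoords N B) : Nonempty (M.Iso N) := by
  -- By `zero` and `surj`, the image of `coord p` consists of all functions supported on the bars
  -- through `p`, so it depends on `B` alone.
  have hr : ∀ p, LinearMap.range (c.coord p) = LinearMap.range (c'.coord p) := by
    intro p
    apply le_antisymm
    · rintro _ ⟨a, rfl⟩
      exact c'.surj p _ fun j => c.zero p a j
    · rintro _ ⟨a, rfl⟩
      exact c.surj p _ fun j => c'.zero p a j
  let e : ∀ p, M.obj p ≃ₗ[F] N.obj p := fun p =>
    (LinearEquiv.ofInjective _ (c.inj p)).trans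
      ((LinearEquiv.ofEq _ _ (hr p)).trans (LinearEquiv.ofInjective _ (c'.inj p)).symm)
  have he : ∀ p a, c'.coord p (e p a) = c.coord p a := by
    intro p a
    have h := LinearEquiv.apply_symm_apply (LinearEquiv.ofInjective _ (c'.inj p))
      (LinearEquiv.ofEq _ _ (hr p) (LinearEquiv.ofInjective _ (c.inj p) a))
    exact congrArg Subtype.val h
  refine ⟨⟨e, fun {p q} h a => c'.inj q ?_⟩⟩
  funext j
  rw [he]
  by_cases hj : q ∈ B j
  · rw [c.map h a j hj, c'.map h _ j hj, he]
  · rw [c.zero q _ j hj, c'.zero q _ j hj]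

/-- The value in `F` of an element of an interval module. -/
def intervalModule.val [DecidableEq Q] (I : FinInterval Q) (p : Q) :
    (intervalModule F I).obj p →ₗ[F] F :=
  Submodule.subtype (if p ∈ I then ⊤ else ⊥ : Submodule F F)

theorem intervalModule.val_injective [DecidableEq Q] (I : FinInterval Q) (p : Q) :
    Function.Injective (intervalModule.val (F := F) I p) :=
  Submodule.subtype_injective _

theorem intervalModule.val_eq_zero [DecidableEq Q] {I : FinInterval Q} {p : Q} (hp : p ∉ I)
    (a : (intervalModule F I).obj p) : intervalModule.val I p a = 0 := by
  have h : intervalModule.val I p a ∈ (if p ∈ I then ⊤ else ⊥ : Submodule F F) :=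
    Subtype.property (show (if p ∈ I then ⊤ else ⊥ : Submodule F F) from a)
  rw [if_neg hp] at h
  exact h

theorem intervalModule.exists_val_eq [DecidableEq Q] {I : FinInterval Q} {p : Q} (x : F)
    (hx : p ∉ I → x = 0) : ∃ a : (intervalModule F I).obj p, intervalModule.val I p a = x := by
  have h : x ∈ (if p ∈ I then ⊤ else ⊥ : Submodule F F) := by
    split_ifs with hp
    · exact Submodule.mem_top
    · exact hx hp
  exact ⟨⟨x, h⟩, rfl⟩

theorem intervalModule.val_map [DecidableEq Q] {I : FinInterval Q} {p q : Q} (h : p ≤ q)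
    (hq : q ∈ I) (a : (intervalModule F I).obj p) :
    intervalModule.val I q ((intervalModule F I).map h a) = intervalModule.val I p a := by
  change (if p ∈ I ∧ q ∈ I then LinearMap.id else 0 : F →ₗ[F] F) (intervalModule.val I p a) = _
  by_cases hp : p ∈ I
  · rw [if_pos ⟨hp, hq⟩, LinearMap.id_apply]
  · rw [val_eq_zero hp, map_zero]

/-- The coordinates of the direct sum of interval modules. -/
noncomputable def BarCoords.directSum [DecidableEq Q] [Finite ι] (B : ι → FinInterval Q) :
    BarCoords (PModule.directSum fun j => intervalModule F (B j)) B where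
  coord p :=
    LinearMap.pi fun j => intervalModule.val (B j) p ∘ₗ
      DirectSum.component F ι (fun j => (intervalModule F (B j)).obj p) j
  inj p a b h :=
    DFinsupp.ext fun j => intervalModule.val_injective (B j) p (congrFun h j)
  zero p a j h := intervalModule.val_eq_zero h _
  surj p f hf := by
    classical
    have := Fintype.ofFinite ι
    choose g hg using fun j => intervalModule.exists_val_eq (F := F) (I := B j) (p := p) (f j) (hf j)
    exact ⟨DFinsupp.equivFunOnFintype.symm g, funext hg⟩
  map h a j hj := by
    refine Eq.trans (congrArg (intervalModule.val (B j) _) ?_) (intervalModule.val_map h hj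
      (DirectSum.component F ι (fun j => (intervalModule F (B j)).obj _) j a))
    exact DirectSum.lmap_apply (fun j => (intervalModule F (B j)).map h) _ _

theorem BarCoords.isBarcode [DecidableEq Q] [Finite ι] {M : PModule F Q} {B : ι → FinInterval Q}
    (c : BarCoords M B) : M.IsBarcode B :=
  c.nonempty_iso (BarCoords.directSum B)

theorem PModule.IsBarcode.nonempty_barCoords [DecidableEq Q] [Finite ι] {M : PModule F Q}
    {B : ι → FinInterval Q} (h : M.IsBarcode B) : Nonempty (BarCoords M B) :=
  h.map fun e => (BarCoords.directSum B).ofIso e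

/-- A pointwise finite-dimensional module over a finite poset has a finite barcode. -/
theorem PModule.IsBarcode.finite [DecidableEq Q] [Finite Q] {M : PModule F Q}
    {B : ι → FinInterval Q} (h : M.IsBarcode B) (hM : ∀ p, Module.Finite F (M.obj p)) :
    Finite ι := by
  classical
  obtain ⟨e⟩ := h
  -- The bars through `p` give linearly independent vectors in a finite-dimensional space. Every bar
  -- passes through one of the finitely many points, so finiteness at each `p` suffices.
  have key : ∀ p, Finite {j // p ∈ B j} := by
    intro p
    choose x hx using fun j : {j // p ∈ B j} =>
      intervalModule.exists_val_eq (F := F) (I := B j) (p := p) 1 fun h => absurd j.2 h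
    let v : {j // p ∈ B j} → DirectSum ι fun j => (intervalModule F (B j)).obj p := fun j =>
      DirectSum.lof F ι (fun j => (intervalModule F (B j)).obj p) j.1 (x j)
    have hv : LinearIndependent F v := by
      rw [linearIndependent_iff']
      intro s g hg i hi
      have h1 := congrArg (fun a => intervalModule.val (B i) p (DirectSum.component F ι
        (fun j => (intervalModule F (B j)).obj p) i.1 a)) hg
      simp only [map_sum, map_smul, map_zero, v] at h1
      rw [Finset.sum_eq_single i] at h1
      · simpa [DirectSum.component.lof_self, hx] using h1
      · intro b _ hb
        rw [DirectSum.component.of, dif_neg (fun h => hb (Subtype.ext h)), map_zero, smul_zero]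
      · exact fun h => absurd hi h
    have hw := hv.map' (e.equiv p).symm.toLinearMap (LinearEquiv.ker _)
    have := hM p
    exact hw.finite
  have : Function.Surjective (fun x : Σ p : Q, {j // p ∈ B j} => x.2.1) := by
    intro j
    obtain ⟨p, hp⟩ := (B j).isInterval.1
    exact ⟨⟨p, j, hp⟩, rfl⟩
  exact Finite.of_surjective _ this

namespace BarCoords

variable {M : PModule F Q} {B : ι → FinInterval Q} (c : BarCoords M B)
include c

theorem exists_linearEquiv (p : Q) : Nonempty (M.obj p ≃ₗ[F] ({j // p ∈ B j} → F)) := by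
  classical
  refine ⟨LinearEquiv.ofBijective (LinearMap.funLeft F F Subtype.val ∘ₗ c.coord p) ⟨?_, ?_⟩⟩
  · intro a b h
    refine c.inj p (funext fun j => ?_)
    by_cases hj : p ∈ B j
    · exact congrFun h ⟨j, hj⟩
    · rw [c.zero p a j hj, c.zero p b j hj]
  · intro f
    obtain ⟨a, ha⟩ := c.surj p (fun j => if h : p ∈ B j then f ⟨j, h⟩ else 0)
      fun j hj => dif_neg hj
    refine ⟨a, funext fun j => ?_⟩
    change c.coord p a j.1 = f j
    rw [ha]
    exact dif_pos j.2

theorem module_finite [Finite ι] (p : Q) : Module.Finite F (M.obj p) := by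
  obtain ⟨e⟩ := c.exists_linearEquiv p
  exact Module.Finite.equiv e.symm

theorem finrank_obj [Finite ι] (p : Q) :
    Module.finrank F (M.obj p) = Nat.card {j // p ∈ B j} := by
  have := Fintype.ofFinite {j // p ∈ B j}
  obtain ⟨e⟩ := c.exists_linearEquiv p
  rw [e.finrank_eq, Module.finrank_fintype_fun_eq_card, Nat.card_eq_fintype_card]

end BarCoords

end Coordinates

/-! ## The generalized rank in coordinates -/

section Rank

variable {F : Type*} [Field F] {Q : Type*} [PartialOrder Q] {ι : Type*}

/-- A function on an interval that does not change along comparable points is constant. -/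
theorem FinInterval.eq_of_forall_le {X : Type*} (I : FinInterval Q) (φ : I.carrier → X)
    (h : ∀ p q : I.carrier, p ≤ q → φ p = φ q) (p q : I.carrier) : φ p = φ q := by
  have key : ∀ y : Q, Relation.ReflTransGen (fun a b => a ∈ (I.carrier : Set Q) ∧
      b ∈ (I.carrier : Set Q) ∧ (a ≤ b ∨ b ≤ a)) p y →
      ∀ hy : y ∈ I.carrier, φ p = φ ⟨y, hy⟩ := by
    intro y hy
    induction hy with
    | refl => exact fun _ => rfl
    | tail _ hbc ih =>
      intro hc
      obtain ⟨hb, _, hle | hle⟩ := hbc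
      · exact (ih hb).trans (h ⟨_, hb⟩ ⟨_, hc⟩ hle)
      · exact (ih hb).trans (h ⟨_, hc⟩ ⟨_, hb⟩ hle).symm
  exact key q (I.isInterval.2.2 p p.2 q q.2) q.2

theorem PModule.limToColim_eq [DecidableEq Q] (M : PModule F Q) (I : FinInterval Q)
    (p q : I.carrier) :
    (M.restrict I.carrier).limToColim p = (M.restrict I.carrier).limToColim q :=
  I.eq_of_forall_le _ (fun _ _ h => (M.restrict I.carrier).limToColim_eq_of_le h) p q

/-- The universal property of the colimit. -/
theorem PModule.exists_colimit_desc [DecidableEq Q] (M : PModule F Q) {W : Type*}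
    [AddCommGroup W] [Module F W] (γ : ∀ p, M.obj p →ₗ[F] W)
    (hγ : ∀ {p q : Q} (h : p ≤ q) a, γ q (M.map h a) = γ p a) :
    ∃ g : M.colimit →ₗ[F] W, ∀ p (s : M.limit), g (M.limToColim p s) = γ p (s.1 p) := by
  refine ⟨M.colimitRel.liftQ (DirectSum.toModule F Q W γ) ?_, fun p s => ?_⟩
  · refine Submodule.span_le.2 ?_
    rintro _ ⟨p, q, h, a, rfl⟩
    simp [DirectSum.toModule_lof, hγ h a]
  · exact DirectSum.toModule_lof F p (s.1 p)

namespace BarCoords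

variable {M : PModule F Q} {B : ι → FinInterval Q} (c : BarCoords M B)
include c

theorem ext_obj {p : Q} {a b : M.obj p} (h : ∀ j, p ∈ B j → c.coord p a j = c.coord p b j) :
    a = b := by
  refine c.inj p (funext fun j => ?_)
  by_cases hj : p ∈ B j
  · exact h j hj
  · rw [c.zero p a j hj, c.zero p b j hj]

/-- Sections over an interval may be prescribed by their coordinates. -/
theorem exists_section (I : FinInterval Q) (t : I.carrier → ι → F)
    (h0 : ∀ (p : I.carrier) j, (p : Q) ∉ B j → t p j = 0)
    (ht : ∀ p q : I.carrier, p ≤ q → ∀ j, (q : Q) ∈ B j → t p j = t q j) :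
    ∃ s : (M.restrict I.carrier).limit, ∀ p : I.carrier, c.coord p (s.1 p) = t p := by
  choose s hs using fun p : I.carrier => c.surj p (t p) (h0 p)
  refine ⟨⟨s, fun {p q} h => c.ext_obj fun j hj => ?_⟩, hs⟩
  refine (c.map (p := (p : Q)) (q := (q : Q)) h (s p) j hj).trans ?_
  rw [hs, hs, ht p q h j hj]

theorem coord_section {I : FinInterval Q} (s : (M.restrict I.carrier).limit) {p q : I.carrier}
    (h : p ≤ q) {j : ι} (hj : (q : Q) ∈ B j) :
    c.coord p (s.1 p) j = c.coord q (s.1 q) j := by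
  rw [← s.2 h]
  exact (c.map (p := (p : Q)) (q := (q : Q)) h (s.1 p) j hj).symm

/-- A section over `I` with vanishing coordinates at the bars containing `I` dies in the colimit. -/
theorem limToColim_eq_zero [DecidableEq Q] [Finite ι] {I : FinInterval Q}
    (s : (M.restrict I.carrier).limit) (p : I.carrier)
    (h : ∀ j, I.carrier ⊆ (B j).carrier → c.coord p (s.1 p) j = 0) :
    (M.restrict I.carrier).limToColim p s = 0 := by
  classical
  have := Fintype.ofFinite ι
  -- The component of a section at a single bar is again a section, so the bars can be treated one
  -- at a time.
  have hex : ∀ j, ∃ s' : (M.restrict I.carrier).limit, ∀ q : I.carrier,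
      c.coord q (s'.1 q) = Pi.single j (c.coord q (s.1 q) j) := by
    intro j
    refine c.exists_section I (fun q => Pi.single j (c.coord q (s.1 q) j)) ?_ ?_
    · intro q i hi
      by_cases hij : i = j
      · subst hij
        simpa using c.zero q _ i hi
      · simp [hij]
    · intro q r hqr i hi
      by_cases hij : i = j
      · subst hij
        simpa using c.coord_section s hqr hi
      · simp [hij]
  choose s' hs' using hex
  have hsum : s = ∑ j, s' j := by
    refine Subtype.ext (funext fun q => c.inj q ?_)
    have h1 : (∑ j, s' j).1 q = ∑ j, (s' j).1 q := by
      rw [AddSubmonoidClass.coe_finsetSum, Finset.sum_apply]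
    rw [h1]
    refine Eq.trans ?_ (map_sum (c.coord q) (fun j => (s' j).1 q) Finset.univ).symm
    exact (Finset.univ_sum_single _).symm.trans
      (Finset.sum_congr rfl fun j _ => (hs' j q).symm)
  rw [hsum, map_sum]
  refine Finset.sum_eq_zero fun j _ => ?_
  -- The map to the colimit may be taken through any point of `I`, so one vanishing value kills the
  -- component. A bar not containing `I` misses some point of `I`, which supplies that value.
  have hz : ∀ q : I.carrier, c.coord q (s.1 q) j = 0 →
      (M.restrict I.carrier).limToColim p (s' j) = 0 := by
    intro q hq
    rw [M.limToColim_eq I p q]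
    have h2 : (s' j).1 q = 0 := c.inj q (by
      rw [hs', hq, Pi.single_zero]
      exact (map_zero (c.coord (q : Q))).symm)
    simp [PModule.limToColim, h2]
  by_cases hj : I.carrier ⊆ (B j).carrier
  · exact hz p (h j hj)
  · obtain ⟨q, hq, hqj⟩ := Finset.not_subset.1 hj
    exact hz ⟨q, hq⟩ (c.zero q _ j hqj)

/-- The generalized rank at `I` is the number of bars that contain `I`. -/
theorem rk_eq [DecidableEq Q] [Finite ι] (I : FinInterval Q) :
    M.rk I = Nat.card {j // I.carrier ⊆ (B j).carrier} := by
  classical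
  have := Fintype.ofFinite {j // I.carrier ⊆ (B j).carrier}
  let N := M.restrict I.carrier
  let p : I.carrier := Classical.arbitrary I.carrier
  let T := {j // I.carrier ⊆ (B j).carrier}
  obtain ⟨g, hg⟩ := N.exists_colimit_desc (W := T → F)
    (fun q : I.carrier => LinearMap.funLeft F F Subtype.val ∘ₗ c.coord (q : Q))
    (fun {q r} h a => funext fun j =>
      c.map (p := (q : Q)) (q := (r : Q)) h a j.1 (j.2 r.2))
  -- `g` reads off the coordinates at the bars containing `I`. It is injective on the image of the
  -- limit by the previous lemma, and surjective thanks to constant sections.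
  have hbij : Function.Bijective (g.domRestrict (LinearMap.range (N.limToColim p))) := by
    constructor
    · rw [← LinearMap.ker_eq_bot, LinearMap.ker_eq_bot']
      rintro ⟨_, s, rfl⟩ hs
      refine Subtype.ext (c.limToColim_eq_zero s p fun j hj => ?_)
      have h1 : g (N.limToColim p s) = 0 := hs
      rw [hg] at h1
      exact congrFun h1 ⟨j, hj⟩
    · intro f
      obtain ⟨s, hs⟩ := c.exists_section I
        (fun (_ : I.carrier) j => if h : I.carrier ⊆ (B j).carrier then f ⟨j, h⟩ else 0)
        (fun q j hj => dif_neg fun h => hj (h q.2)) (fun _ _ _ _ _ => rfl)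
      refine ⟨⟨N.limToColim p s, s, rfl⟩, ?_⟩
      refine (hg p s).trans (funext fun j => ?_)
      change c.coord p (s.1 p) j.1 = f j
      rw [hs]
      exact dif_pos j.2
  change Module.finrank F (LinearMap.range (N.limToColim p)) = _
  rw [(LinearEquiv.ofBijective _ hbij).finrank_eq, Module.finrank_fintype_fun_eq_card,
    Nat.card_eq_fintype_card]

end BarCoords

/-! ## Summands in coordinates -/

namespace BarCoords

variable {M : PModule F Q} {B : ι → FinInterval Q} (c : BarCoords M B)

/-- The submodule of the vectors whose coordinates are supported in `S`. -/
def sub (S : Set ι) : M.Sub where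
  carrier p :=
    { carrier := {a | ∀ j ∉ S, c.coord p a j = 0}
      add_mem' := fun {a b} ha hb j hj => by simp [ha j hj, hb j hj]
      zero_mem' := fun j _ => by simp
      smul_mem' := fun r a ha j hj => by simp [ha j hj] }
  map_mem {p q} h a ha j hj := by
    by_cases hq : q ∈ B j
    · exact (c.map h a j hq).trans (ha j hj)
    · exact c.zero q _ j hq

open Classical in
/-- The coordinates of `c.sub S`. -/
noncomputable def subCoords (S : Set ι) : BarCoords (c.sub S).toPModule fun j : S => B j where
  coord p := LinearMap.funLeft F F Subtype.val ∘ₗ c.coord p ∘ₗ ((c.sub S).carrier p).subtype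
  inj p a b h := by
    refine Subtype.ext (c.inj p (funext fun j => ?_))
    by_cases hj : j ∈ S
    · exact congrFun h ⟨j, hj⟩
    · rw [a.2 j hj, b.2 j hj]
  zero p a j h := c.zero p _ _ h
  surj p f hf := by
    obtain ⟨a, ha⟩ := c.surj p (fun j => if h : j ∈ S then f ⟨j, h⟩ else 0) (by
      intro j hj
      by_cases h : j ∈ S
      · simp [h, hf ⟨j, h⟩ hj]
      · simp [h])
    refine ⟨⟨a, fun j hj => ?_⟩, funext fun j => ?_⟩
    · rw [ha]
      exact dif_neg hj
    · change c.coord p a j.1 = f j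
      rw [ha]
      exact dif_pos j.2
  map h a j hj := c.map h a.1 j hj

theorem isCompl_sub (S : Set ι) (p : Q) :
    IsCompl ((c.sub S).carrier p) ((c.sub Sᶜ).carrier p) := by
  classical
  constructor
  · rw [Submodule.disjoint_def]
    intro a ha ha'
    refine c.inj p (funext fun j => ?_)
    rw [map_zero]
    by_cases hj : j ∈ S
    · exact ha' j (by simpa using hj)
    · exact ha j hj
  · rw [codisjoint_iff, eq_top_iff]
    intro a _
    have h1 : ∀ T : Set ι, ∃ b, c.coord p b = fun j => if j ∈ T then c.coord p a j else 0 :=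
      fun T => c.surj p _ fun j hj => by simp [c.zero p a j hj]
    obtain ⟨b, hb⟩ := h1 S
    obtain ⟨b', hb'⟩ := h1 Sᶜ
    refine Submodule.mem_sup.2 ⟨b, fun j hj => ?_, b', fun j hj => ?_, c.inj p (funext fun j => ?_)⟩
    · rw [hb]
      exact if_neg hj
    · rw [hb']
      exact if_neg hj
    · rw [map_add, hb, hb']
      by_cases hj : j ∈ S <;> simp [hj]

theorem isSummand_sub (S : Set ι) : (c.sub S).IsSummand :=
  ⟨c.sub Sᶜ, c.isCompl_sub S⟩

/-- Reindexing of coordinates. -/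
def reindex {κ : Type*} {B' : κ → FinInterval Q} (e : κ ≃ ι) (h : ∀ k, B (e k) = B' k) :
    BarCoords M B' where
  coord p := LinearMap.funLeft F F e ∘ₗ c.coord p
  inj p := (LinearMap.funLeft_injective_of_surjective F F e e.surjective).comp (c.inj p)
  zero p a j hj := c.zero p a (e j) (by rwa [h])
  surj p f hf := by
    obtain ⟨a, ha⟩ := c.surj p (f ∘ e.symm) fun j hj => hf _ (by rwa [← h, e.apply_symm_apply])
    refine ⟨a, funext fun j => ?_⟩
    change c.coord p a (e j) = f j
    rw [ha]
    simp
  map hpq a j hj := c.map hpq a (e j) (by rwa [h])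

end BarCoords

/-- A submodule that is a pointwise complement of `N` is isomorphic to the quotient by `N`. -/
noncomputable def PModule.Sub.quotientIso {M : PModule F Q} (N R : M.Sub)
    (h : ∀ p, IsCompl (N.carrier p) (R.carrier p)) : N.quotient.Iso R.toPModule where
  equiv p := Submodule.quotientEquivOfIsCompl (N.carrier p) (R.carrier p) (h p)
  natural {p q} hpq a := by
    obtain ⟨b, rfl⟩ :=
      (Submodule.quotientEquivOfIsCompl (N.carrier p) (R.carrier p) (h p)).symm.surjective a
    -- The inverse equivalence sends a vector of `R` to its class, and for that map naturality holds
    -- by definition.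
    refine (LinearEquiv.eq_symm_apply
      (Submodule.quotientEquivOfIsCompl (N.carrier q) (R.carrier q) (h q))).1 ?_
    exact congrArg (fun z => (Submodule.quotientEquivOfIsCompl (N.carrier q) (R.carrier q)
        (h q)).symm (R.toPModule.map hpq z)) (LinearEquiv.apply_symm_apply
        (Submodule.quotientEquivOfIsCompl (N.carrier p) (R.carrier p) (h p)) b).symm

/-- The structure maps preserve both submodules, hence the decomposition. This naturality is what
lets the projection onto a summand descend to colimits. -/
theorem PModule.Sub.projectionOnto_map {M : PModule F Q} (N R : M.Sub)
    (h : ∀ p, IsCompl (N.carrier p) (R.carrier p)) {p q : Q} (hpq : p ≤ q) (a : M.obj p) :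
    Submodule.projectionOnto (N.carrier q) (R.carrier q) (h q) (M.map hpq a) =
      N.toPModule.map hpq (Submodule.projectionOnto (N.carrier p) (R.carrier p) (h p) a) := by
  obtain ⟨x, hx, y, hy, rfl⟩ := Submodule.mem_sup.1
    ((h p).sup_eq_top ▸ Submodule.mem_top : a ∈ N.carrier p ⊔ R.carrier p)
  have key : ∀ r (x y : M.obj r) (hx : x ∈ N.carrier r) (_ : y ∈ R.carrier r),
      Submodule.projectionOnto (N.carrier r) (R.carrier r) (h r) (x + y) = ⟨x, hx⟩ := by
    intro r x y hx hy
    rw [map_add, Submodule.projectionOnto_apply_of_mem_right (h r) hy, add_zero]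
    exact Submodule.projectionOnto_apply_left (h r) ⟨x, hx⟩
  rw [key p x y hx hy, map_add,
    key q _ _ (N.map_mem hpq x hx) (R.map_mem hpq y hy)]
  rfl

/-- Let `I` be contained in no other bar, and let `N` be a summand that is a sum of as many copies
of the interval module of `I` as there are bars `I`. Then the other bars span a complement
of `N`. -/
theorem BarCoords.isCompl_of_isSummand {κ : Type*} [Finite κ] [DecidableEq Q] [Finite ι]
    {M : PModule F Q}
    {B : ι → FinInterval Q} (c : BarCoords M B) {I : FinInterval Q}
    (hI : ∀ j, I.carrier ⊆ (B j).carrier → B j = I) (N : M.Sub) (hN : N.IsSummand)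
    (n : BarCoords N.toPModule fun _ : κ => I) (hκ : Nat.card κ = Nat.card {j // B j = I}) (p : Q) :
    IsCompl (N.carrier p) ((c.sub {j | B j ≠ I}).carrier p) := by
  classical
  have := c.module_finite p
  obtain ⟨N', hN'⟩ := hN
  have hdisj : N.carrier p ⊓ (c.sub {j | B j ≠ I}).carrier p = ⊥ := by
    rw [eq_bot_iff]
    rintro a ⟨haN, haR⟩
    change a = 0
    suffices h : (⟨a, haN⟩ : N.carrier p) = 0 from congrArg Subtype.val h
    refine n.inj p (funext fun i => ?_)
    refine Eq.trans ?_ (congrFun (map_zero (n.coord p)).symm i)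
    by_cases hp : p ∈ I
    swap
    · exact n.zero p _ i hp
    let p' : I.carrier := ⟨p, hp⟩
    -- All bars of `N` equal `I`, so the vector `a` spreads over `I` with constant coordinates.
    obtain ⟨s, hs⟩ := n.exists_section I (fun _ => n.coord p ⟨a, haN⟩)
      (fun q j hq => absurd q.2 hq) (fun _ _ _ _ _ => rfl)
    let t : (M.restrict I.carrier).limit := ⟨fun q => (s.1 q).1, fun {q r} h =>
      congrArg Subtype.val (s.2 h)⟩
    have hsp : s.1 p' = ⟨a, haN⟩ := n.inj p (hs p')
    -- The only bars containing `I` are copies of `I`, and there the coordinates of `a` vanish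
    -- because `a` lies in the span of the other bars.
    have ht : (M.restrict I.carrier).limToColim p' t = 0 := by
      refine c.limToColim_eq_zero t p' fun j hj => ?_
      have h1 : t.1 p' = a := congrArg Subtype.val hsp
      rw [h1]
      exact haR j fun hjS => hjS (hI j hj)
    -- Projecting to `N` and taking coordinates there factors through the colimit, so the
    -- coordinates of `a` can be read off from a class that is zero.
    obtain ⟨g, hg⟩ := (M.restrict I.carrier).exists_colimit_desc (W := κ → F)
      (fun q : I.carrier => n.coord (q : Q) ∘ₗ
        Submodule.projectionOnto (N.carrier (q : Q)) (N'.carrier (q : Q)) (hN' q))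
      (fun {q r} h b => funext fun k =>
        (congrFun (congrArg (n.coord (r : Q)) (N.projectionOnto_map N' hN' h b)) k).trans
          (n.map (p := (q : Q)) (q := (r : Q)) h _ k r.2))
    have h2 := hg p' t
    rw [ht, map_zero] at h2
    have h3 : Submodule.projectionOnto (N.carrier p) (N'.carrier p) (hN' p) (t.1 p') = s.1 p' :=
      Submodule.projectionOnto_apply_left (hN' p) (s.1 p')
    have h4 : n.coord p (Submodule.projectionOnto (N.carrier p) (N'.carrier p) (hN' p)
      (t.1 p')) = 0 := h2.symm
    rw [h3, hsp] at h4
    exact congrFun h4 i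
  refine ⟨disjoint_iff.2 hdisj, ?_⟩
  rw [codisjoint_iff]
  apply Submodule.eq_top_of_finrank_eq
  have h1 := Submodule.finrank_sup_add_finrank_inf_eq (N.carrier p)
    ((c.sub {j | B j ≠ I}).carrier p)
  rw [hdisj, finrank_bot, add_zero] at h1
  have h2 : Module.finrank F (N.carrier p) = Nat.card {_k : κ // p ∈ I} := n.finrank_obj p
  have h3 : Module.finrank F ((c.sub {j | B j ≠ I}).carrier p) =
      Nat.card {j : ({j | B j ≠ I} : Set ι) // p ∈ B j} := (c.subCoords _).finrank_obj p
  -- The dimension of `M` at `p` counts the bars through `p`, split into copies of `I` and the rest.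
  -- Off `I` the first kind is absent on both sides.
  rw [h1, h2, h3, c.finrank_obj p,
    ← Nat.card_congr (Equiv.sumCompl fun x : {j // p ∈ B j} => B x = I), Nat.card_sum]
  congr 1
  · by_cases hp : p ∈ I
    · rw [Nat.card_congr (Equiv.subtypeUnivEquiv fun _ : κ => hp), hκ]
      exact (Nat.card_congr (Equiv.subtypeSubtypeEquivSubtype
        (p := fun j => p ∈ B j) (q := fun j => B j = I) fun h => by rwa [h])).symm
    · have : IsEmpty {_k : κ // p ∈ I} := ⟨fun x => hp x.2⟩
      have : IsEmpty {x : {j // p ∈ B j} // B x = I} := ⟨fun x => hp (x.2 ▸ x.1.2)⟩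
      simp
  · exact Nat.card_congr
      ((Equiv.subtypeSubtypeEquivSubtypeInter (fun j => B j ≠ I) fun j => p ∈ B j).trans
        ((Equiv.subtypeEquivRight fun j => and_comm).trans
          (Equiv.subtypeSubtypeEquivSubtypeInter (fun j => p ∈ B j) fun j => B j ≠ I).symm))

end Rank

/-! ## Termination by an invariant and a measure -/

theorem alwaysHalts_of_invariant {σ : Type*} {step : σ → σ → Prop} {final : σ → Prop}
    (inv : σ → Prop) (meas : σ → ℕ)
    (hstep : ∀ s t, inv s → step s t → inv t ∧ meas t < meas s)
    (hprog : ∀ s, inv s → final s ∨ ∃ t, step s t) {s : σ} (hs : inv s) :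
    AlwaysHalts step final s := by
  constructor
  · induction hn : meas s using Nat.strong_induction_on generalizing s with
    | _ n ih =>
      exact ⟨_, fun t ht => ih (meas t) (hn ▸ (hstep s t hs ht).2) (hstep s t hs ht).1 rfl⟩
  · intro t ht
    refine hprog t ?_
    induction ht with
    | refl => exact hs
    | tail _ h ih => exact (hstep _ _ ih h).1

theorem invariant_of_reflTransGen {σ : Type*} {step : σ → σ → Prop} (inv : σ → Prop)
    (hstep : ∀ s t, inv s → step s t → inv t) {s t : σ} (hs : inv s)
    (h : Relation.ReflTransGen step s t) : inv t := by
  induction h with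
  | refl => exact hs
  | tail _ h ih => exact hstep _ _ ih h

/-! ## Partial barcodes -/

section Output

variable {Q : Type*} [PartialOrder Q] {ι : Type*}

/-- The pairs in `out` are distinct bars of `B`, with their multiplicities. -/
structure IsPartialBarcode (B : ι → FinInterval Q) (out : Output Q) : Prop where
  nodup : (out.map Prod.fst).Nodup
  entry : ∀ x ∈ out, x.1 ∈ Set.range B ∧ x.2 = barMult B x.1

theorem isPartialBarcode_nil (B : ι → FinInterval Q) : IsPartialBarcode B [] :=
  ⟨by simp, by simp⟩

theorem mem_map_fst_append {out : Output Q} {I J : FinInterval Q} {μ : ℤ} :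
    J ∈ (out ++ [(I, μ)]).map Prod.fst ↔ J ∈ out.map Prod.fst ∨ J = I := by
  rw [List.map_append, List.mem_append, List.map_singleton, List.mem_singleton]

theorem IsPartialBarcode.append {B : ι → FinInterval Q} {out : Output Q}
    (h : IsPartialBarcode B out) {I : FinInterval Q} (hI : I ∉ out.map Prod.fst)
    (hB : I ∈ Set.range B) : IsPartialBarcode B (out ++ [(I, (barMult B I : ℤ))]) := by
  constructor
  · rw [List.map_append, List.map_singleton, List.nodup_append]
    refine ⟨h.nodup, List.nodup_singleton _, ?_⟩
    rintro a ha b hb rfl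
    rw [List.mem_singleton.1 hb] at ha
    exact hI ha
  · intro x hx
    rcases List.mem_append.1 hx with hx | hx
    · exact h.entry x hx
    · obtain rfl := List.mem_singleton.1 hx
      exact ⟨hB, rfl⟩

theorem IsPartialBarcode.mem_iff {B : ι → FinInterval Q} {out : Output Q}
    (h : IsPartialBarcode B out) (hall : ∀ j, B j ∈ out.map Prod.fst) (I : FinInterval Q) (μ : ℤ) :
    (I, μ) ∈ out ↔ I ∈ Set.range B ∧ μ = barMult B I := by
  refine ⟨h.entry _, ?_⟩
  rintro ⟨⟨j, rfl⟩, rfl⟩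
  obtain ⟨⟨J, ν⟩, hx, hJ⟩ := List.mem_map.1 (hall j)
  obtain rfl : J = B j := hJ
  rwa [← (h.entry _ hx).2]

/-- The number of bars, with multiplicity, that are not in `out`. -/
noncomputable def numRemaining (B : ι → FinInterval Q) (out : Output Q) : ℕ :=
  Nat.card {j // B j ∉ out.map Prod.fst}

theorem numRemaining_append_lt [Finite ι] {B : ι → FinInterval Q} {out : Output Q}
    {I : FinInterval Q} (hI : I ∉ out.map Prod.fst) (hB : I ∈ Set.range B) (μ : ℤ) :
    numRemaining B (out ++ [(I, μ)]) < numRemaining B out := by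
  obtain ⟨j, rfl⟩ := hB
  refine Set.ncard_lt_ncard (s := {i | B i ∉ (out ++ [(B j, μ)]).map Prod.fst})
    (t := {i | B i ∉ out.map Prod.fst}) ⟨fun i hi h => hi (mem_map_fst_append.2 (Or.inl h)), ?_⟩
    (Set.toFinite _)
  exact fun h => h (show j ∈ {i | B i ∉ out.map Prod.fst} from hI)
    (mem_map_fst_append.2 (Or.inr rfl))

end Output

/-! ## TrueInterval -/

section TrueInterval

variable {F : Type*} [Field F] {Q : Type*} [PartialOrder Q] {ι : Type*}

/-- The invariant of TrueInterval: the bars of the current module are those not yet output. -/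
def TrueState.Inv (B : ι → FinInterval Q) (s : TrueState F Q) : Prop :=
  IsPartialBarcode B s.out ∧
    Nonempty (BarCoords s.module fun j : {j // B j ∉ s.out.map Prod.fst} => B j)

/-- A bar not yet output would make the current module nonzero at each of its points. -/
theorem TrueState.Inv.mem_map_of_isFinal [Finite ι] {B : ι → FinInterval Q}
    {s : TrueState F Q} (hs : s.Inv B) (hf : s.IsFinal) (j : ι) : B j ∈ s.out.map Prod.fst := by
  obtain ⟨-, ⟨c⟩⟩ := hs
  by_contra hj
  obtain ⟨p, hp⟩ := (B j).isInterval.1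
  have h := hf p
  rw [c.finrank_obj, Finite.card_eq_zero_iff] at h
  exact h.elim ⟨⟨j, hj⟩, hp⟩

theorem BarCoords.trueState_inv {B : ι → FinInterval Q} {M : PModule F Q} (c : BarCoords M B) :
    TrueState.Inv B ⟨M, []⟩ :=
  ⟨isPartialBarcode_nil B,
    ⟨c.reindex (Equiv.subtypeUnivEquiv fun _ => List.not_mem_nil) fun _ => rfl⟩⟩

variable [DecidableEq Q] [Finite ι] {B : ι → FinInterval Q}

/-- A strictly larger bar contains itself, so it would have positive rank. -/
theorem BarCoords.eq_of_isMaximalInterval {M : PModule F Q} (c : BarCoords M B)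
    {I : FinInterval Q} (hI : M.IsMaximalInterval I) (j : ι) (hj : I.carrier ⊆ (B j).carrier) :
    B j = I := by
  by_contra hne
  have h1 := hI.2 (B j) (Finset.ssubset_iff_subset_ne.2
    ⟨hj, fun h => hne (FinInterval.ext h.symm)⟩)
  rw [c.rk_eq, Finite.card_eq_zero_iff] at h1
  exact h1.elim ⟨j, Finset.Subset.refl _⟩

theorem BarCoords.rk_eq_of_isMaximalInterval {M : PModule F Q} (c : BarCoords M B)
    {I : FinInterval Q} (hI : M.IsMaximalInterval I) : M.rk I = Nat.card {j // B j = I} := by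
  rw [c.rk_eq]
  exact Nat.card_congr (Equiv.subtypeEquivRight fun j =>
    ⟨c.eq_of_isMaximalInterval hI j, fun h => h ▸ Finset.Subset.refl _⟩)

theorem TrueStep.inv {s t : TrueState F Q} (hst : TrueStep s t) (hs : s.Inv B) :
    t.Inv B ∧ numRemaining B t.out < numRemaining B s.out := by
  obtain ⟨M, out, p, I, N, -, -, hI, hN, hNI⟩ := hst
  obtain ⟨ho, ⟨c⟩⟩ := hs
  have hIB : ∃ j, B j ∉ out.map Prod.fst ∧ B j = I := by
    have h := hI.1
    rw [c.rk_eq_of_isMaximalInterval hI] at h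
    obtain ⟨⟨j, hj⟩⟩ := (Nat.card_pos_iff.1 h).1
    exact ⟨j.1, j.2, hj⟩
  obtain ⟨j, hj, rfl⟩ := hIB
  -- Either all copies of a bar have been output or none, so the multiplicity in the current module
  -- is the original one.
  have hrk : M.rk (B j) = barMult B (B j) := by
    rw [c.rk_eq_of_isMaximalInterval hI]
    exact Nat.card_congr (Equiv.subtypeSubtypeEquivSubtype
      (p := fun i => B i ∉ out.map Prod.fst) (q := fun i => B i = B j) fun h => by rwa [h])
  have hc := c.isCompl_of_isSummand (c.eq_of_isMaximalInterval hI) N hN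
    (PModule.IsBarcode.nonempty_barCoords hNI).some
    (by rw [Nat.card_fin, c.rk_eq_of_isMaximalInterval hI])
  refine ⟨⟨?_, ⟨?_⟩⟩, numRemaining_append_lt hj ⟨j, rfl⟩ _⟩
  · change IsPartialBarcode B (out ++ [(B j, (M.rk (B j) : ℤ))])
    rw [hrk]
    exact ho.append hj ⟨j, rfl⟩
  · refine ((c.subCoords _).ofIso (N.quotientIso _ hc)).reindex
      ((Equiv.subtypeEquivRight fun i => ?_).trans
        (Equiv.subtypeSubtypeEquivSubtypeInter (fun i => B i ∉ out.map Prod.fst)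
          fun i => B i ≠ B j).symm) fun _ => rfl
    rw [mem_map_fst_append, not_or]

theorem BarCoords.exists_trueStep {M : PModule F Q} (c : BarCoords M B) (out : Output Q) {p : Q}
    (hp : Module.finrank F (M.obj p) ≠ 0) : ∃ t, TrueStep ⟨M, out⟩ t := by
  have hne : Nonempty {j // p ∈ B j} := by
    rw [c.finrank_obj] at hp
    exact (Nat.card_ne_zero.1 hp).1
  -- A bar through `p` of largest cardinality is a maximal interval: a strictly larger interval of
  -- positive rank would lie in a bar through `p` with more points.
  obtain ⟨⟨j, hj⟩, hmax⟩ := Finite.exists_max fun j : {j // p ∈ B j} => (B j).carrier.card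
  have hI : M.IsMaximalInterval (B j) := by
    constructor
    · rw [c.rk_eq, Nat.card_pos_iff]
      exact ⟨⟨j, Finset.Subset.refl _⟩, inferInstance⟩
    · intro J hJ
      rw [c.rk_eq, Finite.card_eq_zero_iff]
      refine ⟨fun ⟨i, hi⟩ => ?_⟩
      exact absurd (hmax ⟨i, hi (hJ.1 hj)⟩)
        (not_le.2 ((Finset.card_lt_card hJ).trans_le (Finset.card_le_card hi)))
  let e : Fin (M.rk (B j)) ≃ ({i | B i = B j} : Set ι) :=
    (Finite.equivFinOfCardEq (c.rk_eq_of_isMaximalInterval hI).symm).symm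
  exact ⟨_, TrueStep.peel M out p (B j) (c.sub {i | B i = B j}) hp hj hI (c.isSummand_sub _)
    ((c.subCoords _).reindex e fun k => (e k).2).isBarcode⟩

theorem TrueState.Inv.isFinal_or_exists_step {s : TrueState F Q} (hs : s.Inv B) :
    s.IsFinal ∨ ∃ t, TrueStep s t := by
  obtain ⟨-, ⟨c⟩⟩ := hs
  by_cases h : s.IsFinal
  · exact Or.inl h
  · obtain ⟨p, hp⟩ := not_forall.1 h
    exact Or.inr (c.exists_trueStep s.out hp)

end TrueInterval

/-! ## Growing intervals -/

section Growth

variable {Q : Type*} [PartialOrder Q]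

/-- Connectedness needs only one comparability between `q` and `I`. Convexity needs that no further
point outside `I` lies between them. -/
theorem FinInterval.mem_nbd_of_covering {I : FinInterval Q} {q : Q} (hq : q ∉ I)
    (hadj : ∃ a ∈ I, a ≤ q ∨ q ≤ a)
    (hup : ∀ a ∈ I, ∀ r, a ≤ r → r ≤ q → r ∈ I ∨ r = q)
    (hdown : ∀ a ∈ I, ∀ r, q ≤ r → r ≤ a → r ∈ I ∨ r = q) : q ∈ I.nbd := by
  refine ⟨hq, ⟨q, Set.mem_insert _ _⟩, ?_, ?_⟩
  · rintro a (rfl | ha) b (rfl | hb) r har hrb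
    · exact Or.inl (le_antisymm hrb har)
    · exact (hdown b hb r har hrb).symm
    · exact (hup a ha r har hrb).symm
    · exact Or.inr (I.isInterval.2.1 a ha b hb r har hrb)
  · obtain ⟨a, ha, haq⟩ := hadj
    have hI : ∀ x ∈ I, ∀ y ∈ I, Relation.ReflTransGen (fun a b =>
        a ∈ insert q (I.carrier : Set Q) ∧ b ∈ insert q (I.carrier : Set Q) ∧ (a ≤ b ∨ b ≤ a))
        x y := fun x hx y hy =>
      (I.isInterval.2.2 x hx y hy).lift id fun _ _ h => ⟨Or.inr h.1, Or.inr h.2.1, h.2.2⟩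
    rintro x (rfl | hx) y (rfl | hy)
    · exact Relation.ReflTransGen.refl
    · exact .head ⟨Or.inl rfl, Or.inr ha, haq.symm⟩ (hI a ha y hy)
    · exact .tail (hI x hx a ha) ⟨Or.inr ha, Or.inl rfl, haq⟩
    · exact hI x hx y hy

/-- A proper subinterval of an interval can be enlarged by one point inside it. -/
theorem FinInterval.exists_mem_nbd {I J : FinInterval Q} (h : I.carrier ⊂ J.carrier) :
    ∃ q ∈ J, q ∈ I.nbd := by
  classical
  have hIJ := h.1
  have hne := Finset.exists_of_ssubset h
  -- A path inside the connected set `J` that starts in `I` and ends outside must cross the boundary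
  -- of `I`.
  have hadj : ∃ x ∈ I, ∃ y ∈ J, y ∉ I ∧ (x ≤ y ∨ y ≤ x) := by
    obtain ⟨y, hy, hyI⟩ := hne
    obtain ⟨x, hx⟩ := I.isInterval.1
    by_contra hcon
    push Not at hcon
    have key : ∀ z, Relation.ReflTransGen (fun a b => a ∈ (J.carrier : Set Q) ∧
        b ∈ (J.carrier : Set Q) ∧ (a ≤ b ∨ b ≤ a)) x z → z ∈ I := by
      intro z hz
      induction hz with
      | refl => exact hx
      | tail _ hbc ih =>
        by_contra hc
        have := hcon _ ih _ hbc.2.1 hc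
        tauto
    exact hyI (key y (J.isInterval.2.2 x (hIJ hx) y hy))
  obtain ⟨x, hx, y, hyJ, hyI, hxy | hyx⟩ := hadj
  · obtain ⟨q, hq⟩ := (J.carrier.filter fun z => z ∉ I ∧ ∃ a ∈ I, a ≤ z).exists_minimal
      ⟨y, Finset.mem_filter.2 ⟨hyJ, hyI, x, hx, hxy⟩⟩
    obtain ⟨hqJ, hqI, a, ha, haq⟩ := Finset.mem_filter.1 hq.1
    refine ⟨q, hqJ, mem_nbd_of_covering hqI ⟨a, ha, Or.inl haq⟩ ?_ ?_⟩
    · intro b hb r hbr hrq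
      by_contra hcon
      push Not at hcon
      exact hcon.2 (le_antisymm hrq (hq.2 (Finset.mem_filter.2
        ⟨J.isInterval.2.1 b (hIJ hb) q hqJ r hbr hrq, hcon.1, b, hb, hbr⟩) hrq))
    · intro b hb r hqr hrb
      exact absurd (I.isInterval.2.1 a ha b hb q haq (hqr.trans hrb)) hqI
  · obtain ⟨q, hq⟩ := (J.carrier.filter fun z => z ∉ I ∧ ∃ a ∈ I, z ≤ a).exists_maximal
      ⟨y, Finset.mem_filter.2 ⟨hyJ, hyI, x, hx, hyx⟩⟩
    obtain ⟨hqJ, hqI, a, ha, hqa⟩ := Finset.mem_filter.1 hq.1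
    refine ⟨q, hqJ, mem_nbd_of_covering hqI ⟨a, ha, Or.inr hqa⟩ ?_ ?_⟩
    · intro b hb r hbr hrq
      exact absurd (I.isInterval.2.1 b hb a ha q (hbr.trans hrq) hqa) hqI
    · intro b hb r hqr hrb
      by_contra hcon
      push Not at hcon
      exact hcon.2 (le_antisymm (hq.2 (Finset.mem_filter.2
        ⟨J.isInterval.2.1 q hqJ b (hIJ hb) r hqr hrb, hcon.1, b, hb, hrb⟩) hqr) hqr)

end Growth

/-! ## Interval -/

section Interval

variable {Q : Type*} [PartialOrder Q] {ι : Type*} {B : ι → FinInterval Q}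

/-- Counting the output intervals with a property `p` counts the bars that are output and have the
property `p`. -/
theorem Store.count_eq [Finite ι] {s : Store Q} (hs : IsPartialBarcode B s.out) {l : Finset ℕ}
    (p : FinInterval Q → Prop) (hl : ∀ i, i ∈ l ↔ ∃ x, s.out[i]? = some x ∧ p x.1) :
    s.count l = Nat.card {j // B j ∈ s.out.map Prod.fst ∧ p (B j)} := by
  classical
  have := Fintype.ofFinite ι
  -- Bars are grouped by their position in the output; as the output has no repetitions, position
  -- `i` collects exactly the copies of the `i`-th interval. The default value `0` in `Store.count`
  -- never occurs, since `hl` keeps `l` within range.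
  rw [Nat.card_eq_fintype_card, Fintype.card_subtype, Finset.card_eq_sum_card_fiberwise
    (f := fun j => (s.out.map Prod.fst).idxOf (B j)) (t := l), Store.count, Nat.cast_sum]
  · refine Finset.sum_congr rfl fun i hi => ?_
    obtain ⟨x, hx, hpx⟩ := (hl i).1 hi
    have hxo : x ∈ s.out := List.mem_of_getElem? hx
    have hfst : (s.out.map Prod.fst)[i]? = some x.1 := by
      rw [List.getElem?_map, hx]
      rfl
    obtain ⟨hi', hget⟩ := List.getElem?_eq_some_iff.1 hfst
    rw [hx]
    change x.2 = _
    rw [(hs.entry x hxo).2, barMult, Nat.card_eq_fintype_card, Fintype.card_subtype]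
    congr 2
    ext j
    simp only [Finset.mem_filter, Finset.mem_univ, true_and]
    constructor
    · intro hj
      rw [hj]
      refine ⟨⟨List.mem_map_of_mem hxo, hpx⟩, ?_⟩
      rw [← hget]
      exact hs.nodup.idxOf_getElem i hi'
    · rintro ⟨⟨hj, -⟩, rfl⟩
      rw [← hget]
      exact (List.getElem_idxOf hi').symm
  · intro j hj
    simp only [Finset.coe_filter, Finset.mem_univ, true_and, Set.mem_ofPred_eq] at hj
    refine (hl _).2 ?_
    have hlt := List.idxOf_lt_length_iff.2 hj.1
    have hget := List.getElem_idxOf hlt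
    rw [List.getElem_map] at hget
    exact ⟨_, List.getElem?_eq_getElem (by simpa using hlt), hget ▸ hj.2⟩

/-- The invariant of the global variables of Interval. -/
structure Store.Inv (B : ι → FinInterval Q) (s : Store Q) : Prop where
  out : IsPartialBarcode B s.out
  list : ∀ q i, i ∈ s.list q ↔ ∃ x, s.out[i]? = some x ∧ q ∈ x.1
  d : ∀ q, s.d q = Nat.card {j // B j ∉ s.out.map Prod.fst ∧ q ∈ B j}

/-- The invariant of Interval: some bar that is not yet output contains the current interval, and
no such bar contains a marked point outside. -/
def IntervalState.Inv (B : ι → FinInterval Q) : IntervalState Q → Prop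
  | .head s => s.Inv B
  | .search s I list marked => s.Inv B ∧
      (∀ i, i ∈ list ↔ ∃ x, s.out[i]? = some x ∧ I.carrier ⊆ x.1.carrier) ∧
      (∃ j, B j ∉ s.out.map Prod.fst ∧ I.carrier ⊆ (B j).carrier) ∧
      ∀ q ∈ marked, q ∉ I → ∀ j, B j ∉ s.out.map Prod.fst → I.carrier ⊆ (B j).carrier → q ∉ B j

/-- A measure of the remaining work of Interval. -/
noncomputable def IntervalState.work (B : ι → FinInterval Q) : IntervalState Q → ℕ
  -- A search has at most `Nat.card Q` points to mark and its work is at least 1 above the multiple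
  -- of `Nat.card Q + 3`. The head that starts it lies one above its initial work, and losing one
  -- remaining bar outweighs the `Nat.card Q + 2` of the next head.
  | .head s => numRemaining B s.out * (Nat.card Q + 3) + Nat.card Q + 2
  | .search s _ _ marked =>
      numRemaining B s.out * (Nat.card Q + 3) + (Nat.card Q - marked.card) + 1

theorem Store.Inv.record [DecidableEq Q] [Finite ι] {s : Store Q} (hs : s.Inv B)
    {I : FinInterval Q} (hI : I ∉ s.out.map Prod.fst) (hB : I ∈ Set.range B) :
    (s.record I (barMult B I)).Inv B := by
  refine ⟨hs.out.append hI hB, fun q i => ?_, fun q => ?_⟩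
  · change i ∈ (if q ∈ I then insert s.out.length (s.list q) else s.list q) ↔
      ∃ x, (s.out ++ [(I, (barMult B I : ℤ))])[i]? = some x ∧ q ∈ x.1
    -- Old identifiers are the positions below `s.out.length` and keep their meaning; `s.out.length`
    -- itself names the new pair.
    have key : i ∈ s.list q ↔ i < s.out.length ∧
        ∃ x, (s.out ++ [(I, (barMult B I : ℤ))])[i]? = some x ∧ q ∈ x.1 := by
      rw [hs.list]
      constructor
      · rintro ⟨x, hx, hq⟩
        have hi := (List.getElem?_eq_some_iff.1 hx).1
        exact ⟨hi, x, by rwa [List.getElem?_append_left hi], hq⟩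
      · rintro ⟨hi, x, hx, hq⟩
        exact ⟨x, by rwa [List.getElem?_append_left hi] at hx, hq⟩
    have hlast : s.out.length ≤ i →
        ((∃ x, (s.out ++ [(I, (barMult B I : ℤ))])[i]? = some x ∧ q ∈ x.1) ↔
          i = s.out.length ∧ q ∈ I) := by
      intro hi
      rw [List.getElem?_append_right hi]
      rcases hi.eq_or_lt with rfl | hlt
      · simp
      · rw [List.getElem?_eq_none (by simp; omega)]
        simp [hlt.ne']
    rcases lt_or_ge i s.out.length with hi | hi
    · split_ifs
      · rw [Finset.mem_insert, key]
        simp [hi, hi.ne]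
      · rw [key]
        simp [hi]
    · rw [hlast hi]
      split_ifs with hq
      · rw [Finset.mem_insert, key]
        simp [hq, hi.not_gt]
      · rw [key]
        simp [hq, hi.not_gt]
  · change (if q ∈ I then s.d q - (barMult B I : ℤ) else s.d q) = _
    have hout : (s.record I (barMult B I)).out = s.out ++ [(I, (barMult B I : ℤ))] := rfl
    rw [hs.d, hout]
    split_ifs with hq
    · have hsum : Nat.card {j // B j ∉ s.out.map Prod.fst ∧ q ∈ B j} = barMult B I +
          Nat.card {j // B j ∉ (s.out ++ [(I, (barMult B I : ℤ))]).map Prod.fst ∧ q ∈ B j} := by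
        classical
        have := Fintype.ofFinite ι
        simp only [barMult, Nat.card_eq_fintype_card, Fintype.card_subtype]
        rw [← Finset.card_union_of_disjoint]
        · congr 1
          ext j
          simp only [Finset.mem_union, Finset.mem_filter, Finset.mem_univ, true_and,
            mem_map_fst_append, not_or]
          by_cases hj : B j = I
          · simp [hj, hI, hq]
          · simp [hj]
        · rw [Finset.disjoint_filter]
          rintro j - hj ⟨h, -⟩
          exact h (mem_map_fst_append.2 (Or.inr hj))
      rw [hsum]
      push_cast
      ring
    · congr 1
      refine Nat.card_congr (Equiv.subtypeEquivRight fun j => and_congr_left fun hj => ?_)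
      rw [mem_map_fst_append, not_or]
      exact ⟨fun h => ⟨h, fun h' => hq (h' ▸ hj)⟩, And.left⟩

theorem Store.Inv.mem_map_of_isFinal [Finite ι] {s : Store Q} (hs : s.Inv B)
    (hf : (IntervalState.head s).IsFinal) (j : ι) : B j ∈ s.out.map Prod.fst := by
  by_contra hj
  obtain ⟨p, hp⟩ := (B j).isInterval.1
  have h : s.d p ≤ 0 := hf p
  rw [hs.d] at h
  have h0 : Nat.card {j // B j ∉ s.out.map Prod.fst ∧ p ∈ B j} = 0 := by
    exact_mod_cast le_antisymm h (Nat.cast_nonneg _)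
  rw [Finite.card_eq_zero_iff] at h0
  exact h0.elim ⟨j, hj, hp⟩

variable {F : Type*} [Field F] {M : PModule F Q}

theorem BarCoords.intervalStart_inv [Finite ι] (c : BarCoords M B) :
    (intervalStart M).Inv B := by
  refine ⟨isPartialBarcode_nil B, fun q i => by simp, fun q => ?_⟩
  refine congrArg Nat.cast ((c.finrank_obj q).trans ?_)
  exact Nat.card_congr (Equiv.subtypeEquivRight fun j => by simp)

variable [DecidableEq Q]

/-- `s.count l` removes from the rank the bars containing `I` that are already output. The test of
Interval thus asks whether any remaining bar contains the interval. -/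
theorem BarCoords.rk_eq_count_add [Finite ι] (c : BarCoords M B) {s : Store Q}
    (hs : IsPartialBarcode B s.out) {I : FinInterval Q} {l : Finset ℕ}
    (hl : ∀ i, i ∈ l ↔ ∃ x, s.out[i]? = some x ∧ I.carrier ⊆ x.1.carrier) :
    (M.rk I : ℤ) =
      s.count l + Nat.card {j // B j ∉ s.out.map Prod.fst ∧ I.carrier ⊆ (B j).carrier} := by
  classical
  have := Fintype.ofFinite ι
  rw [Store.count_eq hs (fun J => I.carrier ⊆ J.carrier) hl, c.rk_eq]
  norm_cast
  simp only [Nat.card_eq_fintype_card, Fintype.card_subtype]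
  rw [← Finset.card_union_of_disjoint]
  · congr 1
    ext j
    simp only [Finset.mem_union, Finset.mem_filter, Finset.mem_univ, true_and]
    tauto
  · rw [Finset.disjoint_filter]
    rintro j - ⟨hj, -⟩ ⟨h, -⟩
    exact h hj

theorem IntervalStep.inv [Finite ι] [Finite Q] (c : BarCoords M B) {a b : IntervalState Q}
    (hab : IntervalStep M a b) (ha : a.Inv B) : b.Inv B ∧ b.work B < a.work B := by
  have := Fintype.ofFinite Q
  have hmark : ∀ (marked : Finset Q) (q : Q), q ∉ marked →
      Nat.card Q - (insert q marked).card < Nat.card Q - marked.card := by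
    intro marked q hq
    have h1 := Finset.card_le_univ (insert q marked)
    rw [← Nat.card_eq_fintype_card] at h1
    rw [Finset.card_insert_of_notMem hq] at h1 ⊢
    omega
  -- An identifier determines its interval, so intersecting the lists selects the output intervals
  -- that contain both `I` and `q`.
  have hadd : ∀ {s : Store Q} {I : FinInterval Q} {list : Finset ℕ} (_ : s.Inv B)
      (_ : ∀ i, i ∈ list ↔ ∃ x, s.out[i]? = some x ∧ I.carrier ⊆ x.1.carrier) (q : Q)
      (hq : q ∈ I.nbd) (i), i ∈ list ∩ s.list q ↔
        ∃ x, s.out[i]? = some x ∧ (I.add q hq).carrier ⊆ x.1.carrier := by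
    intro s I list hs hl q hq i
    rw [Finset.mem_inter, hl, hs.list]
    constructor
    · rintro ⟨⟨x, hx, hIx⟩, ⟨y, hy, hqy⟩⟩
      obtain rfl := Option.some.inj (hx.symm.trans hy)
      exact ⟨x, hx, Finset.insert_subset hqy hIx⟩
    · rintro ⟨x, hx, h⟩
      exact ⟨⟨x, hx, (Finset.subset_insert _ _).trans h⟩, x, hx, h (Finset.mem_insert_self _ _)⟩
  cases hab with
  | start s p hp =>
    have hs : s.Inv B := ha
    refine ⟨⟨hs, fun i => ?_, ?_, by simp⟩, ?_⟩
    · rw [hs.list]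
      simp only [FinInterval.single, Finset.singleton_subset_iff]
      rfl
    · rw [hs.d] at hp
      obtain ⟨⟨j, hj, hpj⟩⟩ := (Nat.card_pos_iff.1 (by exact_mod_cast hp)).1
      exact ⟨j, hj, Finset.singleton_subset_iff.2 hpj⟩
    · simp only [IntervalState.work, Finset.card_empty]
      omega
  | accept s I list marked q hq hm h =>
    obtain ⟨hs, hl, -, hmk⟩ := ha
    refine ⟨⟨hs, hadd hs hl q hq, ?_, ?_⟩, ?_⟩
    · rw [c.rk_eq_count_add hs.out (hadd hs hl q hq), lt_add_iff_pos_right] at h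
      obtain ⟨⟨j, hj⟩⟩ := (Nat.card_pos_iff.1 (by exact_mod_cast h)).1
      exact ⟨j, hj⟩
    · intro r hr hrI j hj hIj
      have hrI' : r ≠ q ∧ r ∉ I :=
        not_or.1 fun h => hrI (Finset.mem_insert.2 h)
      exact hmk r (Finset.mem_of_mem_insert_of_ne hr hrI'.1) hrI'.2 j hj
        ((Finset.subset_insert _ _).trans hIj)
    · simp only [IntervalState.work]
      have := hmark marked q hm
      omega
  | reject s I list marked q hq hm h =>
    obtain ⟨hs, hl, hex, hmk⟩ := ha
    refine ⟨⟨hs, hl, hex, ?_⟩, ?_⟩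
    · intro r hr hrI j hj hIj
      -- A failed test leaves no remaining bar that contains both `I` and the rejected point.
      rcases Finset.mem_insert.1 hr with rfl | hr
      · intro hrj
        rw [c.rk_eq_count_add hs.out (hadd hs hl r hq), add_le_iff_nonpos_right] at h
        have h0 : Nat.card {j // B j ∉ s.out.map Prod.fst ∧
            (I.add r hq).carrier ⊆ (B j).carrier} = 0 := by
          exact_mod_cast le_antisymm h (Nat.cast_nonneg _)
        rw [Finite.card_eq_zero_iff] at h0
        exact h0.elim ⟨j, hj, Finset.insert_subset hrj hIj⟩
      · exact hmk r hr hrI j hj hIj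
    · simp only [IntervalState.work]
      have := hmark marked q hm
      omega
  | finish s I list marked h =>
    obtain ⟨hs, hl, ⟨j, hj, hIj⟩, hmk⟩ := ha
    -- A larger remaining bar would contain a neighbor of `I`; all neighbors are marked, and marked
    -- points outside `I` lie in no such bar.
    have heq : ∀ i, B i ∉ s.out.map Prod.fst → I.carrier ⊆ (B i).carrier → B i = I := by
      intro i hi hIi
      by_contra hne
      obtain ⟨q, hq, hqn⟩ := FinInterval.exists_mem_nbd (Finset.ssubset_iff_subset_ne.2
        ⟨hIi, fun h => hne (FinInterval.ext h.symm)⟩)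
      exact hmk q (h q hqn) hqn.1 i hi hIi hq
    obtain rfl := heq j hj hIj
    have hμ : (M.rk (B j) : ℤ) - s.count list = barMult B (B j) := by
      rw [c.rk_eq_count_add hs.out hl, add_sub_cancel_left, barMult]
      congr 1
      exact Nat.card_congr (Equiv.subtypeEquivRight fun i =>
        ⟨fun h => heq i h.1 h.2, fun h => by simp only [h]; exact ⟨hj, Finset.Subset.refl _⟩⟩)
    rw [hμ]
    refine ⟨hs.record hj ⟨j, rfl⟩, ?_⟩
    have hlt : numRemaining B (s.record (B j) (barMult B (B j))).out < numRemaining B s.out :=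
      numRemaining_append_lt hj ⟨j, rfl⟩ _
    have hmul := Nat.mul_le_mul_right (Nat.card Q + 3) (Nat.succ_le_of_lt hlt)
    rw [Nat.succ_mul] at hmul
    simp only [IntervalState.work]
    omega

/-- The accept and reject tests are complementary, so a search never stalls. -/
theorem IntervalState.isFinal_or_exists_step (a : IntervalState Q) :
    a.IsFinal ∨ ∃ b, IntervalStep M a b := by
  cases a with
  | head s =>
    by_cases h : ∀ p, s.d p ≤ 0
    · exact Or.inl h
    · push Not at h
      obtain ⟨p, hp⟩ := h
      exact Or.inr ⟨_, .start s p hp⟩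
  | search s I list marked =>
    right
    by_cases h : ∀ q ∈ I.nbd, q ∈ marked
    · exact ⟨_, .finish s I list marked h⟩
    · push Not at h
      obtain ⟨q, hq, hm⟩ := h
      rcases lt_or_ge (s.count (list ∩ s.list q)) (M.rk (I.add q hq) : ℤ) with h | h
      · exact ⟨_, .accept s I list marked q hq hm h⟩
      · exact ⟨_, .reject s I list marked q hq hm h⟩

end Interval

/-! ## Correctness -/

theorem algorithms_correct {F : Type*} [Field F] {Q : Type*} [PartialOrder Q] [DecidableEq Q]
    [Finite Q] (M : PModule F Q) (hM : ∀ p, Module.Finite F (M.obj p)) {ι : Type*}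
    (B : ι → FinInterval Q) (hB : M.IsBarcode B) :
    AlwaysHalts (IntervalStep M) IntervalState.IsFinal (intervalStart M) ∧
    AlwaysHalts TrueStep TrueState.IsFinal ⟨M, []⟩ ∧
    ∀ out out' : Output Q, IntervalOutputs M out → TrueIntervalOutputs M out' →
      (∀ (I : FinInterval Q) (μ : ℤ), (I, μ) ∈ out ↔ (I, μ) ∈ out') ∧
      (∀ (I : FinInterval Q) (μ : ℤ), (I, μ) ∈ out ↔ I ∈ Set.range B ∧ μ = barMult B I) ∧
      (out.map Prod.fst).Nodup ∧ (out'.map Prod.fst).Nodup := by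
  have := hB.finite hM
  obtain ⟨c⟩ := hB.nonempty_barCoords
  refine ⟨alwaysHalts_of_invariant (IntervalState.Inv B) (IntervalState.work B)
      (fun _ _ hs h => h.inv c hs) (fun a _ => a.isFinal_or_exists_step) c.intervalStart_inv,
    alwaysHalts_of_invariant (TrueState.Inv B) (fun s => numRemaining B s.out)
      (fun _ _ hs h => h.inv hs) (fun _ hs => hs.isFinal_or_exists_step) c.trueState_inv, ?_⟩
  rintro _ _ ⟨s, hs, hsf, rfl⟩ ⟨t, ht, htf, rfl⟩
  have hsi : s.Inv B := invariant_of_reflTransGen (IntervalState.Inv B)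
    (fun _ _ hs h => (h.inv c hs).1) c.intervalStart_inv hs
  have hti : t.Inv B := invariant_of_reflTransGen (TrueState.Inv B)
    (fun _ _ hs h => (h.inv hs).1) c.trueState_inv ht
  have h1 := hsi.out.mem_iff (hsi.mem_map_of_isFinal hsf)
  have h2 := hti.1.mem_iff (hti.mem_map_of_isFinal htf)
  exact ⟨fun I μ => (h1 I μ).trans (h2 I μ).symm, h1, hsi.out.nodup, hti.1.nodup⟩

/-! ### Finite-dimensionality of simplicial homology, and the theorem for filtrations -/

theorem module_finite_subQuot {F : Type*} [Field F] {E : Type*} [AddCommGroup E] [Module F E]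
    (Z B : Submodule F E) [Module.Finite F Z] : Module.Finite F (SubQuot Z B) :=
  inferInstanceAs (Module.Finite F (Z ⧸ B.submoduleOf Z))

theorem module_finite_homology {F : Type*} [Field F] {V : Type*} [LinearOrder V]
    (A : PreAbstractSimplicialComplex V) (hA : A.faces.Finite) (k : ℕ) :
    Module.Finite F (Homology F A k) := by
  have hfin : Finite {σ | σ ∈ A ∧ σ.card = k + 1} :=
    (hA.subset fun _ h => h.1).to_subtype
  have : Module.Finite F (chains F A k) :=
    Module.Finite.equiv (Finsupp.supportedEquivFinsupp (R := F) (M := F)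
      {σ | σ ∈ A ∧ σ.card = k + 1}).symm
  have : Module.Finite F (cycles F A k) := Submodule.finiteDimensional_of_le inf_le_left
  exact module_finite_subQuot _ _

end GenPers

theorem mainTheorem7 {F : Type*} [Field F] {V : Type*} [LinearOrder V]
    (K : PreAbstractSimplicialComplex V) (hK : K.faces.Finite)
    (P : Finset (ℤ × ℤ)) (hP : GenPers.IsInterval (P : Set (ℤ × ℤ)))
    (𝓕 : P →o Set.Iic K) (k : ℕ)
    {ι : Type*} (B : ι → GenPers.FinInterval P)
    (hB : (GenPers.homologyModule F 𝓕 k).IsBarcode B) :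
    -- every run of either algorithm terminates properly
    GenPers.AlwaysHalts (GenPers.IntervalStep (GenPers.homologyModule F 𝓕 k))
      GenPers.IntervalState.IsFinal
      (GenPers.intervalStart (GenPers.homologyModule F 𝓕 k)) ∧
    GenPers.AlwaysHalts GenPers.TrueStep GenPers.TrueState.IsFinal
      ⟨GenPers.homologyModule F 𝓕 k, []⟩ ∧
    -- the outputs of any two complete runs coincide, and they list the barcode
    ∀ out out' : GenPers.Output P,
      GenPers.IntervalOutputs (GenPers.homologyModule F 𝓕 k) out →
      GenPers.TrueIntervalOutputs (GenPers.homologyModule F 𝓕 k) out' →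
      (∀ (I : GenPers.FinInterval P) (μ : ℤ), (I, μ) ∈ out ↔ (I, μ) ∈ out') ∧
      (∀ (I : GenPers.FinInterval P) (μ : ℤ),
        (I, μ) ∈ out ↔ I ∈ Set.range B ∧ μ = GenPers.barMult B I) ∧
      (out.map Prod.fst).Nodup ∧ (out'.map Prod.fst).Nodup := by
  have hM : ∀ p, Module.Finite F ((GenPers.homologyModule F 𝓕 k).obj p) := fun p =>
    GenPers.module_finite_homology _ (hK.subset (𝓕 p).2) k
  exact GenPers.algorithms_correct _ hM B hB
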